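/- Let $A\in\mathbb{R}^{m\times N}$, let $r\le \operatorname{rank}A$ and $f>1$. Transposed pre-maxvol selects $r$ columns of $A$ one by one: at every step it adds a column for which the squared length of the projection on the orthogonal complement of the columns already selected is maximal (ties are broken arbitrarily). Dominant-R with parameter $f$ starts from the selected set $\mathcal I$ of $r$ column indices and repeats the following. It forms a QR decomposition $\hat A=\tilde Q\tilde R$ of the submatrix $\hat A=A_{:,\mathcal I}\in\mathbb{R}^{m\times r}$, with $\tilde Q^T\tilde Q=I$ and $\tilde R$ upper triangular, and for each position $i$ of a selected column and each $j\notin\mathcal I$ computes $$m_{ij}=|(\tilde R^{-1}\tilde Q^TA)_{ij}|^2+\gamma_j\omega_i,\qquad \gamma_j=\|A_{:,j}\|_2^2-\|(\tilde Q^TA)_{:,j}\|_2^2,\qquad \omega_i=\|(\tilde R^{-1})_{i,:}\|_2^2 .$$ If the largest $m_{ij}$ exceeds $f$, it replaces the $i$-th selected column by column $j$ for a maximizing pair $(i,j)$; otherwise (or if no pair exists) it stops. Then Dominant-R, started from an output of transposed pre-maxvol, stops after at most $c\,r\log_f r$ column swaps, where $c$ is an absolute constant. For the resulting submatrix $\hat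 A\in\mathbb{R}^{m\times r}$, with its columns in any order, and for any QR decomposition $\hat A=\tilde Q\tilde R$, the matrices $Q=\tilde Q$ and $R=\tilde Q^TA$ are, up to a column permutation that puts the selected columns first, a strong rank-revealing QR decomposition of $A$ with factor $f$ in the sense of Gu and Eisenstat. That is: let $P$ be a permutation matrix for which $AP$ starts with $\hat A$, and let $[\tilde Q\ Q_\perp]$ be any completion of $\tilde Q$ to an orthogonal matrix. Then $$AP=[\tilde Q\ Q_\perp]\begin{bmatrix}\tilde R&B\\0&C\end{bmatrix},\qquad RP=[\tilde R\ B],$$ $\tilde R$ is invertible, and for all $1\le i\le r$ and $1\le j\le N-r$ $$\sigma_i(\tilde R)\ge\frac{\sigma_i(A)}{\sqrt{1+f^2r(N-r)}},\qquad \sigma_j(C)\le\sigma_{r+j}(A)\sqrt{1+f^2r(N-r)},\qquad |(\tilde R^{-1}B)_{ij}|\le f ,$$ where $\sigma_k$ is the $k$-th largest singular value, taken as $0$ beyond the size of the matrix. -/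

import Mathlib

namespace MaxVolume

open Matrix

/-- The `i`-th row of `B`, as a vector with the Euclidean norm. -/
noncomputable def rowVec {M n : ℕ} (B : Matrix (Fin M) (Fin n) ℝ) (i : Fin M) :
    EuclideanSpace ℝ (Fin n) :=
  WithLp.toLp 2 (B i)

/-- The entry `γ i` used by pre-maxvol once the rows in `S` have been selected: the squared length
of the `i`-th row of `B` after projection on the orthogonal complement of the rows in `S`. -/
noncomputable def residualSq {M n : ℕ} (B : Matrix (Fin M) (Fin n) ℝ) (S : Set (Fin M))
    (i : Fin M) : ℝ :=
  ‖(Submodule.span ℝ (rowVec B '' S))ᗮ.starProjection (rowVec B i)‖ ^ 2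

/-- `I` is an output of pre-maxvol on the rows of `B` with required rank `r` (for some way of
breaking ties): `s 0, …, s (r - 1)` are the successively selected row indices, each one maximizing
the current `γ`, and `I` is the set of the selected indices. -/
def IsPreMaxvolOutput {M n : ℕ} (B : Matrix (Fin M) (Fin n) ℝ) (r : ℕ)
    (I : Finset (Fin M)) : Prop :=
  ∃ s : Fin r → Fin M,
    (∀ (k : Fin r) (i : Fin M),
      residualSq B (s '' {l | l < k}) i ≤ residualSq B (s '' {l | l < k}) (s k)) ∧
    I = Finset.univ.image s

/-- `Ahat = Q R` is a (thin) QR decomposition: `Q` has orthonormal columns and `R` is upper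
triangular. No sign convention is imposed on the diagonal of `R`. -/
structure IsQR {m r : ℕ} (Ahat : Matrix (Fin m) (Fin r) ℝ)
    (Q : Matrix (Fin m) (Fin r) ℝ) (R : Matrix (Fin r) (Fin r) ℝ) : Prop where
  eq_mul : Ahat = Q * R
  orthonormal_columns : Qᵀ * Q = 1
  upper_triangular : ∀ i j : Fin r, j < i → R i j = 0

/-- `J` lists the elements of the set `I` of `r` column indices, each exactly once. -/
def Enumerates {N r : ℕ} (J : Fin r → Fin N) (I : Finset (Fin N)) : Prop :=
  Function.Injective J ∧ Finset.univ.image J = I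

/-- `γ j`: the squared length of the `j`-th column of `A` minus that of the `j`-th column
of `Qᵀ A`. -/
def colResidual {m N r : ℕ} (A : Matrix (Fin m) (Fin N) ℝ) (Q : Matrix (Fin m) (Fin r) ℝ)
    (j : Fin N) : ℝ :=
  ∑ a, A a j ^ 2 - ∑ l, (Qᵀ * A) l j ^ 2

/-- `ω i`: the squared length of the `i`-th row of `R⁻¹`. -/
noncomputable def invRowSq {r : ℕ} (R : Matrix (Fin r) (Fin r) ℝ) (i : Fin r) : ℝ :=
  ∑ l, R⁻¹ i l ^ 2

/-- The quantity `m i j = |(R⁻¹ Qᵀ A) i j|² + γ j * ω i` that Dominant-R computes from the QR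
decomposition of the current submatrix; here `i` is the position of a selected column and `j` is
the index of a column outside the selection. -/
noncomputable def exchangeFactor {m N r : ℕ} (A : Matrix (Fin m) (Fin N) ℝ)
    (Q : Matrix (Fin m) (Fin r) ℝ) (R : Matrix (Fin r) (Fin r) ℝ) (i : Fin r) (j : Fin N) : ℝ :=
  |(R⁻¹ * (Qᵀ * A)) i j| ^ 2 + colResidual A Q j * invRowSq R i

/-- One column swap of Dominant-R with parameter `f` on `A`: some QR decomposition of the selected
columns (listed in some order `J`) is formed, a pair `(i, j)` maximizing `m` is chosen, `m i j > f`
holds, and the `i`-th selected column is replaced by the column `j`. -/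
def DominantRStep {m N : ℕ} (A : Matrix (Fin m) (Fin N) ℝ) (r : ℕ) (f : ℝ)
    (I I' : Finset (Fin N)) : Prop :=
  ∃ (J : Fin r → Fin N) (Q : Matrix (Fin m) (Fin r) ℝ) (R : Matrix (Fin r) (Fin r) ℝ),
    Enumerates J I ∧ IsQR (A.submatrix id J) Q R ∧
    ∃ (i : Fin r) (j : Fin N), j ∉ I ∧
      (∀ (i' : Fin r) (j' : Fin N), j' ∉ I →
        exchangeFactor A Q R i' j' ≤ exchangeFactor A Q R i j) ∧
      f < exchangeFactor A Q R i j ∧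
      I' = insert j (I.erase (J i))

/-- The stopping test of Dominant-R with parameter `f`: no `m i j` exceeds `f`. -/
def DominantRStops {m N : ℕ} (A : Matrix (Fin m) (Fin N) ℝ) (r : ℕ) (f : ℝ)
    (I : Finset (Fin N)) : Prop :=
  ∃ (J : Fin r → Fin N) (Q : Matrix (Fin m) (Fin r) ℝ) (R : Matrix (Fin r) (Fin r) ℝ),
    Enumerates J I ∧ IsQR (A.submatrix id J) Q R ∧
    ∀ (i : Fin r) (j : Fin N), j ∉ I → exchangeFactor A Q R i j ≤ f

/-- `S 0, S 1, …, S k` are the successive selections of Dominant-R during its first `k` column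
swaps. -/
def IsDominantRRun {m N : ℕ} (A : Matrix (Fin m) (Fin N) ℝ) (r : ℕ) (f : ℝ) (k : ℕ)
    (S : ℕ → Finset (Fin N)) : Prop :=
  ∀ t < k, DominantRStep A r f (S t) (S (t + 1))

/-- The `i`-th largest singular value of a matrix, counted from `0`; it is `0` beyond the size of
the matrix. -/
noncomputable def sval {a b : ℕ} (X : Matrix (Fin a) (Fin b) ℝ) (i : ℕ) : ℝ :=
  (Matrix.toEuclideanLin X).singularValues i

/-- Strong rank-revealing QR decomposition with factor `f` in the sense of Gu and Eisenstat:
`M P = Q [A B; 0 C]` with `Q` orthogonal, `A` invertible and upper triangular of order `r`,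
`σ_i(A) ≥ σ_i(M) / √(1 + f² r (N - r))`, `σ_j(C) ≤ σ_{r+j}(M) √(1 + f² r (N - r))` and
`|(A⁻¹ B)_{ij}| ≤ f`. The permutation sends the positions `Sum.inl _` of the leading columns and
`Sum.inr _` of the trailing columns to column indices of `M`. -/
structure IsStrongRRQR {m N r : ℕ} (f : ℝ) (M : Matrix (Fin m) (Fin N) ℝ)
    (Q : Matrix (Fin m) (Fin r ⊕ Fin (m - r)) ℝ)
    (A : Matrix (Fin r) (Fin r) ℝ) (B : Matrix (Fin r) (Fin (N - r)) ℝ)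
    (C : Matrix (Fin (m - r)) (Fin (N - r)) ℝ)
    (P : Fin r ⊕ Fin (N - r) ≃ Fin N) : Prop where
  factorization : M.submatrix id P = Q * Matrix.fromBlocks A B 0 C
  orthogonal_left : Qᵀ * Q = 1
  orthogonal_right : Q * Qᵀ = 1
  upper_triangular : ∀ i j : Fin r, j < i → A i j = 0
  invertible : IsUnit A.det
  leading : ∀ i < r,
    sval M i / Real.sqrt (1 + f ^ 2 * (r : ℝ) * ((N : ℝ) - (r : ℝ))) ≤ sval A i
  trailing : ∀ j < N - r,
    sval C j ≤ sval M (r + j) * Real.sqrt (1 + f ^ 2 * (r : ℝ) * ((N : ℝ) - (r : ℝ)))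
  entries : ∀ (i : Fin r) (j : Fin (N - r)), |(A⁻¹ * B) i j| ≤ f

/-- The thin pair `(Q, R)` with `r` columns, respectively `r` rows, is, with the column permutation
`P`, a strong rank-revealing QR decomposition of `M` with factor `f`: `Q` can be completed by
orthonormal columns `Q'` to an orthogonal matrix, and for every such completion `[Q Q']` the
orthogonal factor `[Q Q']`, the leading `r` rows `R P` and the trailing block of `Q'ᵀ M P` form
a strong rank-revealing QR decomposition. -/
def IsThinStrongRRQR {m N r : ℕ} (f : ℝ) (M : Matrix (Fin m) (Fin N) ℝ)
    (Q : Matrix (Fin m) (Fin r) ℝ) (R : Matrix (Fin r) (Fin N) ℝ)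
    (P : Fin r ⊕ Fin (N - r) ≃ Fin N) : Prop :=
  (∃ Q' : Matrix (Fin m) (Fin (m - r)) ℝ,
    (Matrix.fromCols Q Q')ᵀ * Matrix.fromCols Q Q' = 1) ∧
  ∀ Q' : Matrix (Fin m) (Fin (m - r)) ℝ,
    (Matrix.fromCols Q Q')ᵀ * Matrix.fromCols Q Q' = 1 →
    IsStrongRRQR f M (Matrix.fromCols Q Q')
      (R.submatrix id (fun i => P (Sum.inl i)))
      (R.submatrix id (fun j => P (Sum.inr j)))
      ((Q'ᵀ * M).submatrix id (fun j => P (Sum.inr j))) P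

end MaxVolume

namespace MaxVolume

open Matrix

/-! Everything is measured by squared volume, the Gram determinant of the selected columns
(`colVolSq`). By `IsQR.colVolSq_update`, `m i j` is exactly the factor by which a swap changes it,
so each swap gains more than a factor `f`.

The greedy start is already near-optimal: `det_gram_le_of_greedy` shows that no choice of `r`
columns beats it by more than `(r!)²`. The induction projects along the first greedy vector. This
turns a Gram matrix into a rank-one update, and `det_add_vecMulVec_le` bounds its determinant at the
cost of a factor `n²`. Hence `f ^ k ≤ (r!)² ≤ r ^ (2 r)`, so `k ≤ 2 r log_f r`. The same comparison
with `r` independent columns gives the start a nonzero volume, and swaps preserve this.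

At termination, `m i j ≤ f` summed over all pairs reads `‖R⁻¹B‖² + ‖C‖² ‖R⁻¹‖² ≤ f r (N - r)` in
Frobenius norms. This single number controls both families of singular values
(`sval_le_sval_leading`, `sval_trailing_le_sval`) by Courant–Fischer arguments with explicit test
spaces. The entry bound comes from one `m i j` alone. -/

lemma norm_sq_toLp {n : ℕ} (v : Fin n → ℝ) :
    ‖(WithLp.toLp 2 v : EuclideanSpace ℝ (Fin n))‖ ^ 2 = v ⬝ᵥ v := by
  rw [EuclideanSpace.real_norm_sq_eq]
  simp [dotProduct, sq]

lemma norm_sq_eq_sum_repr {E : Type*} [NormedAddCommGroup E] [InnerProductSpace ℝ E] {n : ℕ}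
    (b : OrthonormalBasis (Fin n) ℝ E) (v : E) :
    ‖v‖ ^ 2 = ∑ k, b.repr v k ^ 2 := by
  rw [← b.repr.norm_map, EuclideanSpace.real_norm_sq_eq]

/-! ### Courant–Fischer bounds for singular values. -/

section Singular

variable {E F : Type*} [NormedAddCommGroup E] [InnerProductSpace ℝ E] [FiniteDimensional ℝ E]
  [NormedAddCommGroup F] [InnerProductSpace ℝ F] [FiniteDimensional ℝ F]

/-- In an eigenbasis of `Tᵀ T`, sorted by decreasing eigenvalue, `T` scales the squared coordinates
by the squared singular values. -/
lemma exists_basis_norm_sq_eq (T : E →ₗ[ℝ] F) {n : ℕ} (hn : Module.finrank ℝ E = n) :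
    ∃ b : OrthonormalBasis (Fin n) ℝ E, ∀ v : E,
      ‖T v‖ ^ 2 = ∑ k : Fin n, T.singularValues k ^ 2 * b.repr v k ^ 2 := by
  have hs := T.isSymmetric_adjoint_comp_self
  refine ⟨hs.eigenvectorBasis hn, fun v => ?_⟩
  have h1 : ‖T v‖ ^ 2 = inner ℝ v ((LinearMap.adjoint T ∘ₗ T) v) := by
    rw [LinearMap.comp_apply, LinearMap.adjoint_inner_right, real_inner_self_eq_norm_sq]
  rw [h1, ← (hs.eigenvectorBasis hn).repr.inner_map_map, PiLp.inner_apply]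
  refine Finset.sum_congr rfl fun k _ => ?_
  rw [hs.eigenvectorBasis_apply_self_apply, ← T.sq_singularValues_fin hn]
  simp
  ring

/-- Some `i` linear conditions force `‖T v‖ ≤ σᵢ ‖v‖`. -/
lemma exists_conditions_norm_le (T : E →ₗ[ℝ] F) {i : ℕ} (hi : i < Module.finrank ℝ E) :
    ∃ φ : E →ₗ[ℝ] (Fin i → ℝ), ∀ v, φ v = 0 → ‖T v‖ ^ 2 ≤ T.singularValues i ^ 2 * ‖v‖ ^ 2 := by
  obtain ⟨b, hb⟩ := exists_basis_norm_sq_eq T rfl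
  -- The conditions annihilate the first `i` eigencoordinates; every remaining one is scaled by at
  -- most `σᵢ`.
  refine ⟨LinearMap.pi fun k => (EuclideanSpace.proj (Fin.castLE hi.le k)).toLinearMap ∘ₗ
    b.repr.toLinearEquiv.toLinearMap, fun v hv => ?_⟩
  rw [hb, norm_sq_eq_sum_repr b v, Finset.mul_sum]
  refine Finset.sum_le_sum fun k _ => ?_
  by_cases hk : (k : ℕ) < i
  · have := congrFun hv ⟨k, hk⟩
    have h0 : b.repr v k = 0 := by simpa using this
    simp [h0]
  · have := T.singularValues_antitone (not_lt.1 hk)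
    have h0 := T.singularValues_nonneg k
    gcongr

/-- On some subspace of dimension `i + 1` one has `σᵢ ‖v‖ ≤ ‖T v‖`. -/
lemma exists_injective_le_norm (T : E →ₗ[ℝ] F) {i : ℕ} (hi : i < Module.finrank ℝ E) :
    ∃ ψ : (Fin (i + 1) → ℝ) →ₗ[ℝ] E, Function.Injective ψ ∧
      ∀ z, T.singularValues i ^ 2 * ‖ψ z‖ ^ 2 ≤ ‖T (ψ z)‖ ^ 2 := by
  obtain ⟨b, hb⟩ := exists_basis_norm_sq_eq T rfl
  have hinj := Fin.castLE_injective (Nat.succ_le_of_lt hi)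
  have hli := b.orthonormal.linearIndependent.comp _ hinj
  refine ⟨Fintype.linearCombination ℝ fun k => b (Fin.castLE (Nat.succ_le_of_lt hi) k), ?_,
    fun z => ?_⟩
  · exact linearIndependent_iff_injective_fintypeLinearCombination.1 hli
  · set v := Fintype.linearCombination ℝ (fun k => b (Fin.castLE (Nat.succ_le_of_lt hi) k)) z
      with hv
    rw [hb, norm_sq_eq_sum_repr b v, Finset.mul_sum]
    refine Finset.sum_le_sum fun k _ => ?_
    by_cases hk : (k : ℕ) ≤ i
    · have := T.singularValues_antitone hk
      have h0 := T.singularValues_nonneg i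
      gcongr
    · have h0 : b.repr v k = 0 := by
        rw [b.repr_apply_apply, hv, Fintype.linearCombination_apply, inner_sum]
        refine Finset.sum_eq_zero fun l _ => ?_
        have : k ≠ Fin.castLE (Nat.succ_le_of_lt hi) l := by
          rintro rfl
          have := l.2
          simp at hk
          omega
        rw [inner_smul_right, b.inner_eq_ite, if_neg this, mul_zero]
      simp [h0]

/-- A linear system with fewer equations than unknowns has a nonzero solution. -/
lemma exists_ne_zero_of_conditions {G : Type*} [AddCommGroup G] [Module ℝ G]
    [FiniteDimensional ℝ G] {i : ℕ} (hi : i < Module.finrank ℝ G) (φ : G →ₗ[ℝ] (Fin i → ℝ)) :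
    ∃ z, z ≠ 0 ∧ φ z = 0 := by
  have := φ.ker_ne_bot_of_finrank_lt (by simpa using hi)
  obtain ⟨z, hz, h0⟩ := Submodule.exists_mem_ne_zero_of_ne_bot this
  exact ⟨z, h0, hz⟩

/-- The subspace of dimension `i + 1` where `T` stretches by at least `σᵢ` meets the kernel of any
`i` conditions. Past the dimension of `E` the singular value is `0`. -/
lemma singularValues_le_of_conditions (T : E →ₗ[ℝ] F) {i : ℕ} {t : ℝ} (ht : 0 ≤ t)
    (φ : E →ₗ[ℝ] (Fin i → ℝ)) (h : ∀ v, φ v = 0 → ‖T v‖ ^ 2 ≤ t ^ 2 * ‖v‖ ^ 2) :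
    T.singularValues i ≤ t := by
  rcases lt_or_ge i (Module.finrank ℝ E) with hi | hi
  · obtain ⟨ψ, hψ, hT⟩ := exists_injective_le_norm T hi
    obtain ⟨z, hz, h0⟩ := exists_ne_zero_of_conditions (G := Fin (i + 1) → ℝ) (by simp) (φ ∘ₗ ψ)
    have h1 := (hT z).trans (h (ψ z) h0)
    have hpos : 0 < ‖ψ z‖ ^ 2 := by
      have : ψ z ≠ 0 := fun h => hz (hψ (by simpa using h))
      positivity
    exact le_of_sq_le_sq (le_of_mul_le_mul_right h1 hpos) ht
  · rw [T.singularValues_of_finrank_le hi]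
    exact ht

/-- Dual dimension count. The test space `G` is left abstract because it is later a product of two
coordinate spaces. -/
lemma le_singularValues_of_injective (T : E →ₗ[ℝ] F) {G : Type*} [AddCommGroup G] [Module ℝ G]
    [FiniteDimensional ℝ G] {i : ℕ} {t : ℝ} (hi : i < Module.finrank ℝ G)
    (ψ : G →ₗ[ℝ] E) (hψ : Function.Injective ψ)
    (h : ∀ z, t ^ 2 * ‖ψ z‖ ^ 2 ≤ ‖T (ψ z)‖ ^ 2) :
    t ≤ T.singularValues i := by
  have hi' : i < Module.finrank ℝ E := hi.trans_le (LinearMap.finrank_le_finrank_of_injective hψ)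
  obtain ⟨φ, hφ⟩ := exists_conditions_norm_le T hi'
  obtain ⟨z, hz, h0⟩ := exists_ne_zero_of_conditions hi (φ ∘ₗ ψ)
  have h1 := (h z).trans (hφ (ψ z) h0)
  have hpos : 0 < ‖ψ z‖ ^ 2 := by
    have : ψ z ≠ 0 := fun h => hz (hψ (by simpa using h))
    positivity
  exact le_of_sq_le_sq (le_of_mul_le_mul_right h1 hpos) (T.singularValues_nonneg i)

end Singular

/-! ### The same bounds for matrices and dot products. -/

section Sval

variable {a b : ℕ} (X : Matrix (Fin a) (Fin b) ℝ)

lemma norm_sq_toEuclideanLin (v : EuclideanSpace ℝ (Fin b)) :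
    ‖X.toEuclideanLin v‖ ^ 2 = (X *ᵥ v.ofLp) ⬝ᵥ (X *ᵥ v.ofLp) := by
  rw [← norm_sq_toLp]; rfl

lemma norm_sq_ofLp (v : EuclideanSpace ℝ (Fin b)) : ‖v‖ ^ 2 = v.ofLp ⬝ᵥ v.ofLp :=
  norm_sq_toLp v.ofLp

lemma sval_nonneg (i : ℕ) : 0 ≤ sval X i := LinearMap.singularValues_nonneg _ i

lemma exists_conditions_sval {i : ℕ} (hi : i < b) :
    ∃ φ : (Fin b → ℝ) →ₗ[ℝ] (Fin i → ℝ), ∀ v, φ v = 0 →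
      (X *ᵥ v) ⬝ᵥ (X *ᵥ v) ≤ sval X i ^ 2 * (v ⬝ᵥ v) := by
  obtain ⟨φ, hφ⟩ := exists_conditions_norm_le X.toEuclideanLin (i := i) (by simpa using hi)
  refine ⟨φ ∘ₗ (WithLp.linearEquiv 2 ℝ (Fin b → ℝ)).symm.toLinearMap, fun v hv => ?_⟩
  have := hφ (WithLp.toLp 2 v) hv
  rwa [norm_sq_toEuclideanLin, norm_sq_ofLp] at this

lemma exists_injective_sval {i : ℕ} (hi : i < b) :
    ∃ ψ : (Fin (i + 1) → ℝ) →ₗ[ℝ] (Fin b → ℝ), Function.Injective ψ ∧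
      ∀ z, sval X i ^ 2 * (ψ z ⬝ᵥ ψ z) ≤ (X *ᵥ ψ z) ⬝ᵥ (X *ᵥ ψ z) := by
  obtain ⟨ψ, hψ, h⟩ := exists_injective_le_norm X.toEuclideanLin (i := i) (by simpa using hi)
  refine ⟨(WithLp.linearEquiv 2 ℝ (Fin b → ℝ)).toLinearMap ∘ₗ ψ,
    (WithLp.linearEquiv 2 ℝ (Fin b → ℝ)).injective.comp hψ, fun z => ?_⟩
  have := h z
  rwa [norm_sq_toEuclideanLin, norm_sq_ofLp] at this

lemma sval_le_of_conditions {i : ℕ} {t : ℝ} (ht : 0 ≤ t) (φ : (Fin b → ℝ) →ₗ[ℝ] (Fin i → ℝ))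
    (h : ∀ v, φ v = 0 → (X *ᵥ v) ⬝ᵥ (X *ᵥ v) ≤ t ^ 2 * (v ⬝ᵥ v)) : sval X i ≤ t := by
  refine singularValues_le_of_conditions _ ht
    (φ ∘ₗ (WithLp.linearEquiv 2 ℝ (Fin b → ℝ)).toLinearMap) fun v hv => ?_
  rw [norm_sq_toEuclideanLin, norm_sq_ofLp]
  exact h _ hv

lemma le_sval_of_injective {G : Type*} [AddCommGroup G] [Module ℝ G]
    [FiniteDimensional ℝ G] {i : ℕ} {t : ℝ} (hi : i < Module.finrank ℝ G)
    (ψ : G →ₗ[ℝ] (Fin b → ℝ)) (hψ : Function.Injective ψ)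
    (h : ∀ z, t ^ 2 * (ψ z ⬝ᵥ ψ z) ≤ (X *ᵥ ψ z) ⬝ᵥ (X *ᵥ ψ z)) : t ≤ sval X i := by
  refine le_singularValues_of_injective _ hi
    ((WithLp.linearEquiv 2 ℝ (Fin b → ℝ)).symm.toLinearMap ∘ₗ ψ)
    ((WithLp.linearEquiv 2 ℝ (Fin b → ℝ)).symm.injective.comp hψ) fun z => ?_
  rw [norm_sq_toEuclideanLin, norm_sq_ofLp]
  exact h z

end Sval

/-! ### Determinants of rank-one updates. -/

section RankOne

variable {n : Type*} [Fintype n] [DecidableEq n]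

/-- Multilinearity applied to one row at a time: terms with `v` in two rows vanish, so only
first-order terms survive. -/
lemma det_add_vecMulVec_aux (A : Matrix n n ℝ) (u v : n → ℝ) (s : Finset n) :
    (Matrix.of fun i j => if i ∈ s then A i j + u i * v j else A i j).det =
      A.det + ∑ i ∈ s, u i * (A.updateRow i v).det := by
  induction s using Finset.induction_on with
  | empty => simp; rfl
  | insert k s hk ih =>
    set M : Matrix n n ℝ := Matrix.of fun i j => if i ∈ s then A i j + u i * v j else A i j
      with hM
    have hMk : M k = A k := by ext j; simp [hM, hk]
    have h1 : (Matrix.of fun i j => if i ∈ insert k s then A i j + u i * v j else A i j) =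
        M.updateRow k (M k + u k • v) := by
      ext i j
      by_cases hi : i = k
      · subst hi; simp [hMk]
      · simp [hi, hM, updateRow_ne]
    -- Once row `k` is `v`, the multiples of `v` added to the other rows can be cleared by row
    -- operations.
    have h2 : (M.updateRow k v).det = (A.updateRow k v).det := by
      refine det_eq_of_forall_row_eq_smul_add_const (fun i => if i ∈ s then u i else 0) k
        (by simp [hk]) fun i j => ?_
      by_cases hi : i = k
      · subst hi; simp [hk]
      · by_cases his : i ∈ s <;> simp [hi, hM, updateRow_ne, his]
    rw [h1, det_updateRow_add, det_updateRow_smul, updateRow_eq_self, ih, h2,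
      Finset.sum_insert hk]
    ring

/-- The matrix determinant lemma, without any invertibility assumption. -/
lemma det_add_vecMulVec (A : Matrix n n ℝ) (u v : n → ℝ) :
    (A + vecMulVec u v).det = A.det + v ⬝ᵥ (A.adjugate *ᵥ u) := by
  have h := det_add_vecMulVec_aux A u v Finset.univ
  have e : (Matrix.of fun i j => if i ∈ Finset.univ then A i j + u i * v j else A i j) =
      A + vecMulVec u v := by
    ext i j; simp [vecMulVec_apply]
  rw [e] at h
  have h2 : ∀ i, (A.updateRow i v).det = (A.adjugateᵀ *ᵥ v) i := fun i => by
    rw [← cramer_transpose_apply, cramer_eq_adjugate_mulVec, adjugate_transpose]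
  rw [h]
  congr 1
  simp_rw [h2]
  change u ⬝ᵥ (A.adjugateᵀ *ᵥ v) = _
  rw [mulVec_transpose, dotProduct_comm, dotProduct_mulVec]

lemma adjugate_transpose_mul_self_apply (B : Matrix n n ℝ) (i j : n) :
    (Bᵀ * B).adjugate i j = ∑ l, B.adjugate i l * B.adjugate j l := by
  rw [adjugate_mul_distrib, ← adjugate_transpose, mul_apply]
  rfl

/-- Since `adj (BᵀB) = adj B (adj B)ᵀ`, the quadratic form is a sum of squares of `n`-term sums;
Cauchy–Schwarz costs the factor `n`. Working with a factor `B` avoids inverting `G`, which may be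
singular. -/
lemma dotProduct_adjugate_mulVec_le (B : Matrix n n ℝ) (y : n → ℝ) :
    y ⬝ᵥ ((Bᵀ * B).adjugate *ᵥ y) ≤
      Fintype.card n * ∑ i, y i ^ 2 * (Bᵀ * B).adjugate i i := by
  have h1 : y ⬝ᵥ ((Bᵀ * B).adjugate *ᵥ y) = ∑ l, (∑ i, y i * B.adjugate i l) ^ 2 := by
    rw [adjugate_mul_distrib, ← adjugate_transpose, ← mulVec_mulVec, dotProduct_mulVec,
      ← mulVec_transpose]
    simp only [dotProduct, mulVec, transpose_apply, ← sq]
    simp only [mul_comm]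
  have h2 : ∑ i, y i ^ 2 * (Bᵀ * B).adjugate i i = ∑ l, ∑ i, (y i * B.adjugate i l) ^ 2 := by
    rw [Finset.sum_comm]
    refine Finset.sum_congr rfl fun i _ => ?_
    rw [adjugate_transpose_mul_self_apply, Finset.mul_sum]
    exact Finset.sum_congr rfl fun l _ => by ring
  rw [h1, h2, Finset.mul_sum]
  exact Finset.sum_le_sum fun l _ => sq_sum_le_card_mul_sum_sq

/-- Cauchy–Schwarz on the cofactor expansion of `det B` along column `i`. -/
lemma det_transpose_mul_self_le (B : Matrix n n ℝ) (i : n) :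
    (Bᵀ * B).det ≤ (Bᵀ * B) i i * (Bᵀ * B).adjugate i i := by
  have h1 : B.det = ∑ l, B l i * B.adjugate i l := det_eq_sum_mul_adjugate_col B i
  rw [det_mul, det_transpose, ← sq, h1, adjugate_transpose_mul_self_apply, mul_apply]
  simp only [← sq, transpose_apply]
  exact Finset.sum_mul_sq_le_sq_mul_sq _ _ _

lemma adjugate_transpose_mul_self_nonneg (B : Matrix n n ℝ) (i : n) :
    0 ≤ (Bᵀ * B).adjugate i i := by
  rw [adjugate_transpose_mul_self_apply]
  exact Finset.sum_nonneg fun l _ => mul_self_nonneg _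

/-- If the diagonal of `G + y yᵀ` is at most `ρ`, then its determinant is at most
`n ρ tr (adj G)`. -/
lemma det_add_vecMulVec_le [hn : Nonempty n] {G : Matrix n n ℝ} (hG : G.PosSemidef) (y : n → ℝ) {ρ : ℝ}
    (h : ∀ i, G i i + y i ^ 2 ≤ ρ) :
    (G + vecMulVec y y).det ≤ Fintype.card n * (ρ * ∑ i, G.adjugate i i) := by
  obtain ⟨B, rfl⟩ : ∃ B : Matrix n n ℝ, G = Bᵀ * B := by
    open scoped MatrixOrder ComplexOrder in
    obtain ⟨B, hB⟩ := CStarAlgebra.nonneg_iff_eq_star_mul_self.1 hG.nonneg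
    exact ⟨B, by simpa [star_eq_conjTranspose] using hB⟩
  rw [det_add_vecMulVec]
  have hc : (1 : ℝ) ≤ Fintype.card n := by exact_mod_cast Fintype.card_pos
  have h1 : (Bᵀ * B).det ≤ ∑ i, (Bᵀ * B) i i * (Bᵀ * B).adjugate i i := by
    obtain ⟨i⟩ := hn
    refine (det_transpose_mul_self_le B i).trans ?_
    refine Finset.single_le_sum (f := fun i => (Bᵀ * B) i i * (Bᵀ * B).adjugate i i)
      (fun j _ => mul_nonneg ?_ (adjugate_transpose_mul_self_nonneg B j)) (Finset.mem_univ i)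
    exact hG.diag_nonneg
  have h2 : 0 ≤ ∑ i, (Bᵀ * B) i i * (Bᵀ * B).adjugate i i :=
    Finset.sum_nonneg fun j _ =>
      mul_nonneg hG.diag_nonneg (adjugate_transpose_mul_self_nonneg B j)
  calc _ ≤ Fintype.card n * ∑ i, (Bᵀ * B) i i * (Bᵀ * B).adjugate i i +
        Fintype.card n * ∑ i, y i ^ 2 * (Bᵀ * B).adjugate i i :=
        add_le_add (h1.trans (le_mul_of_one_le_left h2 hc)) (dotProduct_adjugate_mulVec_le B y)
    _ ≤ _ := by
        rw [← mul_add, ← Finset.sum_add_distrib]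
        refine mul_le_mul_of_nonneg_left ?_ (Nat.cast_nonneg (α := ℝ) _)
        rw [Finset.mul_sum]
        refine Finset.sum_le_sum fun i _ => ?_
        rw [← add_mul]
        exact mul_le_mul_of_nonneg_right (h i) (adjugate_transpose_mul_self_nonneg B i)

end RankOne

/-! ### Gram determinants and greedy selection. -/

section Greedy

variable {E : Type*} [NormedAddCommGroup E] [InnerProductSpace ℝ E]

lemma det_gram_nonneg {n : Type*} [Fintype n] [DecidableEq n] (v : n → E) :
    0 ≤ (gram ℝ v).det := (posSemidef_gram ℝ v).det_nonneg

/-- Pythagoras along `x`. The case `x = 0` is included because `‖0‖⁻¹ = 0`. -/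
lemma inner_eq_inner_starProjection_add {x : E} (v w : E) :
    inner ℝ v w = inner ℝ ((ℝ ∙ x)ᗮ.starProjection v) ((ℝ ∙ x)ᗮ.starProjection w) +
      (‖x‖⁻¹ * inner ℝ x v) * (‖x‖⁻¹ * inner ℝ x w) := by
  have hv := (ℝ ∙ x).starProjection_add_starProjection_orthogonal v
  have hw := (ℝ ∙ x).starProjection_add_starProjection_orthogonal w
  have h1 : ∀ a b : E, inner ℝ ((ℝ ∙ x).starProjection a) ((ℝ ∙ x)ᗮ.starProjection b) = 0 :=
    fun a b => Submodule.inner_right_of_mem_orthogonal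
      (Submodule.starProjection_apply_mem _ _) (Submodule.starProjection_apply_mem _ _)
  conv_lhs => rw [← hv, ← hw]
  rw [inner_add_left, inner_add_right, inner_add_right, h1,
    real_inner_comm ((ℝ ∙ x).starProjection w) ((ℝ ∙ x)ᗮ.starProjection v), h1]
  rw [Submodule.starProjection_singleton, Submodule.starProjection_singleton]
  rw [inner_smul_left, inner_smul_right, real_inner_self_eq_norm_sq]
  by_cases hx : x = 0
  · simp [hx]
  · have : ‖x‖ ≠ 0 := by simpa using hx
    simp
    field_simp
    ring

lemma gram_eq_add_vecMulVec {n : Type*} (x : E) (v : n → E) :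
    gram ℝ v = gram ℝ (fun i => (ℝ ∙ x)ᗮ.starProjection (v i)) +
      vecMulVec (fun i => ‖x‖⁻¹ * inner ℝ x (v i)) fun i => ‖x‖⁻¹ * inner ℝ x (v i) := by
  ext i j
  simp only [gram_apply, Matrix.add_apply, vecMulVec_apply]
  exact inner_eq_inner_starProjection_add _ _

lemma adjugate_gram_diag {n : ℕ} (v : Fin (n + 1) → E) (i : Fin (n + 1)) :
    (gram ℝ v).adjugate i i = (gram ℝ (v ∘ i.succAbove)).det := by
  rw [adjugate_fin_succ_eq_det_submatrix, Even.neg_one_pow ⟨_, rfl⟩, one_mul]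
  rfl

/-- The Gram matrix is the projected one plus a rank-one term, with diagonal at most `‖x‖²`.
Diagonal cofactors of the projected matrix are Gram determinants of `n` projected vectors, bounded
by `B`. One factor `n + 1` comes from Cauchy–Schwarz, the other from the number of cofactors. -/
lemma det_gram_le_of_norm_le {n : ℕ} (v : Fin (n + 1) → E) (x : E) (h : ∀ i, ‖v i‖ ≤ ‖x‖)
    {B : ℝ} (hB : ∀ i : Fin (n + 1),
      (gram ℝ (fun k => (ℝ ∙ x)ᗮ.starProjection (v (i.succAbove k)))).det ≤ B) :
    (gram ℝ v).det ≤ ((n + 1 : ℕ) : ℝ) ^ 2 * (‖x‖ ^ 2 * B) := by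
  rw [gram_eq_add_vecMulVec x v]
  refine (det_add_vecMulVec_le (posSemidef_gram ℝ _) _ (ρ := ‖x‖ ^ 2) fun i => ?_).trans ?_
  · rw [sq, gram_apply, ← inner_eq_inner_starProjection_add, real_inner_self_eq_norm_sq]
    have := h i
    gcongr
  · have : ∑ i, (gram ℝ (fun i => (ℝ ∙ x)ᗮ.starProjection (v i))).adjugate i i ≤
        ∑ _i : Fin (n + 1), B := Finset.sum_le_sum fun i _ => by
      rw [adjugate_gram_diag]; exact hB i
    rw [Finset.sum_const, Finset.card_univ, Fintype.card_fin, nsmul_eq_mul] at this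
    rw [Fintype.card_fin]
    calc _ ≤ ((n + 1 : ℕ) : ℝ) * (‖x‖ ^ 2 * (((n + 1 : ℕ) : ℝ) * B)) :=
          mul_le_mul_of_nonneg_left (mul_le_mul_of_nonneg_left this (sq_nonneg _))
            (Nat.cast_nonneg _)
      _ = _ := by ring

/-- Volume is length times projected volume. After projection along `v 0`, row and column `0` of the
Gram matrix vanish, so its determinant is `0` and only the corner cofactor contributes to the
update. -/
lemma det_gram_cons {n : ℕ} (v : Fin (n + 1) → E) :
    (gram ℝ v).det =
      ‖v 0‖ ^ 2 * (gram ℝ fun k : Fin n => (ℝ ∙ v 0)ᗮ.starProjection (v k.succ)).det := by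
  set P : E → E := fun w => (ℝ ∙ v 0)ᗮ.starProjection w with hP
  have hP0 : P (v 0) = 0 := by
    refine Submodule.starProjection_orthogonal_apply_eq_zero ?_
    exact Submodule.mem_span_singleton_self _
  set G := gram ℝ (fun i => P (v i)) with hG
  have hG0 : ∀ j, G 0 j = 0 := fun j => by simp [hG, hP0]
  have hG1 : ∀ j, G j 0 = 0 := fun j => by simp [hG, hP0]
  have hadj : ∀ i j, i ≠ 0 ∨ j ≠ 0 → G.adjugate i j = 0 := by
    intro i j hij
    rw [adjugate_apply]
    by_cases hj : j = 0
    · refine det_eq_zero_of_column_eq_zero 0 fun k => ?_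
      have hi : i ≠ 0 := hij.resolve_right (not_not.2 hj)
      by_cases hk : k = j
      · subst hk; simp [hi.symm]
      · rw [updateRow_ne hk, hG1]
    · refine det_eq_zero_of_row_eq_zero 0 fun k => ?_
      rw [updateRow_ne (Ne.symm hj), hG0]
  rw [gram_eq_add_vecMulVec (v 0) v, det_add_vecMulVec]
  change G.det + _ ⬝ᵥ (G.adjugate *ᵥ _) = _
  rw [det_eq_zero_of_row_eq_zero 0 hG0, zero_add, dotProduct,
    Finset.sum_eq_single 0 _ (by simp)]
  · rw [mulVec, dotProduct, Finset.sum_eq_single 0 _ (by simp)]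
    · rw [hG, adjugate_gram_diag, real_inner_self_eq_norm_sq]
      have e : ((fun i => P (v i)) ∘ (0 : Fin (n + 1)).succAbove) = fun k => P (v k.succ) := by
        ext k; simp
      rw [e]
      by_cases hx : ‖v 0‖ = 0
      · simp [hx]
      · field_simp
        rfl
    · intro j _ hj
      rw [hadj _ _ (Or.inr hj), zero_mul]
  · intro i _ hi
    rw [mulVec, dotProduct, Finset.sum_eq_zero, mul_zero]
    intro j _
    rw [hadj _ _ (Or.inl hi), zero_mul]

variable [FiniteDimensional ℝ E]

/-- One Gram–Schmidt step: removing `x` first and then the projected `T` removes the whole span. It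
lets the greedy hypothesis pass to the tail of the selection among projected vectors. -/
lemma starProjection_span_insert_orthogonal (x : E) (T : Set E) (v : E) :
    (Submodule.span ℝ (insert x T))ᗮ.starProjection v =
      (Submodule.span ℝ ((fun w => (ℝ ∙ x)ᗮ.starProjection w) '' T))ᗮ.starProjection
        ((ℝ ∙ x)ᗮ.starProjection v) := by
  set p : E → E := fun w => (ℝ ∙ x)ᗮ.starProjection w with hp
  set K := Submodule.span ℝ (p '' T) with hK
  have hpx : ∀ w, inner ℝ x (p w) = 0 := fun w =>
    Submodule.inner_right_of_mem_orthogonal (Submodule.mem_span_singleton_self x)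
      (Submodule.starProjection_apply_mem _ _)
  have hpsub : ∀ w, ∃ c : ℝ, w = p w + c • x := fun w => by
    have h1 := (ℝ ∙ x).starProjection_add_starProjection_orthogonal w
    obtain ⟨c, hc⟩ := Submodule.mem_span_singleton.1
      (Submodule.starProjection_apply_mem (ℝ ∙ x) w)
    exact ⟨c, by rw [hc, add_comm]; exact h1.symm⟩
  have hKx : K ≤ (ℝ ∙ x)ᗮ := by
    rw [hK, Submodule.span_le]
    rintro _ ⟨w, _, rfl⟩
    exact Submodule.starProjection_apply_mem _ _
  have hKle : K ≤ Submodule.span ℝ (insert x T) := by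
    rw [hK, Submodule.span_le]
    rintro _ ⟨w, hw, rfl⟩
    obtain ⟨c, hc⟩ := hpsub w
    have : p w = w - c • x := by rw [eq_sub_iff_add_eq]; exact hc.symm
    rw [this]
    exact Submodule.sub_mem _ (Submodule.subset_span (Set.mem_insert_of_mem _ hw))
      (Submodule.smul_mem _ _ (Submodule.subset_span (Set.mem_insert _ _)))
  have hdec := K.starProjection_add_starProjection_orthogonal (p v)
  have hmem := Submodule.starProjection_apply_mem K (p v)
  have hux : inner ℝ x (Kᗮ.starProjection (p v)) = 0 := by
    have h1 : inner ℝ x (K.starProjection (p v)) = 0 :=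
      Submodule.inner_right_of_mem_orthogonal (Submodule.mem_span_singleton_self x) (hKx hmem)
    have h2 := hpx v
    rw [← hdec, inner_add_right, h1, zero_add] at h2
    exact h2
  refine (Submodule.eq_starProjection_of_mem_orthogonal ?_ ?_)
  · rw [Submodule.mem_orthogonal]
    intro u hu
    induction hu using Submodule.span_induction with
    | mem u hu =>
      rcases hu with rfl | hu
      · exact hux
      · obtain ⟨c, hc⟩ := hpsub u
        have h1 : inner ℝ (p u) (Kᗮ.starProjection (p v)) = 0 :=
          Submodule.inner_right_of_mem_orthogonal (Submodule.subset_span (Set.mem_image_of_mem p hu))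
            (Submodule.starProjection_apply_mem _ _)
        rw [hc, inner_add_left, inner_smul_left, h1, hux]
        simp
    | zero => simp
    | add a b _ _ ha hb => rw [inner_add_left, ha, hb, add_zero]
    | smul c a _ ha => rw [inner_smul_left, ha, mul_zero]
  · refine Submodule.le_orthogonal_orthogonal _ ?_
    obtain ⟨c, hc⟩ := hpsub v
    have : v - Kᗮ.starProjection (p v) = K.starProjection (p v) + c • x := by
      rw [sub_eq_iff_eq_add, add_right_comm, hdec]; exact hc
    rw [this]
    exact Submodule.add_mem _ (hKle hmem)
      (Submodule.smul_mem _ _ (Submodule.subset_span (Set.mem_insert _ _)))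

/-- Greedy selection of `r` vectors reaches the largest volume up to the factor `r!`. -/
theorem det_gram_le_of_greedy {ι : Type*} {r : ℕ} (a : ι → E) (s : Fin r → ι)
    (hs : ∀ k i, ‖(Submodule.span ℝ (a '' (s '' {l | l < k})))ᗮ.starProjection (a i)‖ ≤
      ‖(Submodule.span ℝ (a '' (s '' {l | l < k})))ᗮ.starProjection (a (s k))‖)
    (J : Fin r → ι) :
    (gram ℝ (a ∘ J)).det ≤ (r.factorial : ℝ) ^ 2 * (gram ℝ (a ∘ s)).det := by
  induction r generalizing a with
  | zero => simp
  | succ r ih =>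
    set x := a (s 0) with hx
    set a' : ι → E := fun i => (ℝ ∙ x)ᗮ.starProjection (a i) with ha'
    have himg : ∀ k : Fin r, a '' (s '' {l | l < k.succ}) =
        insert x (a '' ((s ∘ Fin.succ) '' {l | l < k})) := by
      intro k
      ext w
      simp only [Set.mem_image, Set.mem_ofPred_eq, exists_exists_and_eq_and, Set.mem_insert_iff,
        Function.comp]
      constructor
      · rintro ⟨l, hl, rfl⟩
        induction l using Fin.cases with
        | zero => exact Or.inl rfl
        | succ l => exact Or.inr ⟨l, Fin.succ_lt_succ_iff.1 hl, rfl⟩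
      · rintro (rfl | ⟨l, hl, rfl⟩)
        · exact ⟨0, Fin.succ_pos _, rfl⟩
        · exact ⟨l.succ, Fin.succ_lt_succ_iff.2 hl, rfl⟩
    have hs' : ∀ k i, ‖(Submodule.span ℝ (a' '' ((s ∘ Fin.succ) '' {l | l < k})))ᗮ.starProjection
        (a' i)‖ ≤ ‖(Submodule.span ℝ (a' '' ((s ∘ Fin.succ) '' {l | l < k})))ᗮ.starProjection
        (a' ((s ∘ Fin.succ) k))‖ := by
      intro k i
      have h := hs k.succ i
      rw [himg, starProjection_span_insert_orthogonal, starProjection_span_insert_orthogonal,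
        Set.image_image] at h
      exact h
    have h0 : ∀ i, ‖a i‖ ≤ ‖x‖ := by
      intro i
      have h := hs 0 i
      have e : {l : Fin (r + 1) | l < 0} = ∅ := by ext; simp
      rw [e, Set.image_empty, Set.image_empty, Submodule.span_empty] at h
      simpa [Submodule.starProjection_top] using h
    have key := det_gram_le_of_norm_le (a ∘ J) x (fun i => h0 _)
      (fun i => ih a' (s ∘ Fin.succ) hs' (J ∘ i.succAbove))
    refine key.trans (le_of_eq ?_)
    rw [det_gram_cons (a ∘ s), Nat.factorial_succ]
    push_cast
    simp only [Function.comp_def, ← hx, ha']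
    ring

end Greedy

/-- The squared volume of the columns of `A` listed by `J`. -/
noncomputable def colVolSq {m N r : ℕ} (A : Matrix (Fin m) (Fin N) ℝ) (J : Fin r → Fin N) : ℝ :=
  (gram ℝ (rowVec Aᵀ ∘ J)).det

/-! ### Volume change under a column exchange. -/

section Exchange

variable {m N r : ℕ} {A : Matrix (Fin m) (Fin N) ℝ} {J : Fin r → Fin N}
  {Q : Matrix (Fin m) (Fin r) ℝ} {R : Matrix (Fin r) (Fin r) ℝ}

lemma gram_rowVec_transpose (A : Matrix (Fin m) (Fin N) ℝ) (J : Fin r → Fin N) :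
    gram ℝ (rowVec Aᵀ ∘ J) = (A.submatrix id J)ᵀ * A.submatrix id J := by
  ext k l
  simp [gram_apply, rowVec, mul_apply, PiLp.inner_apply, mul_comm]

lemma colVolSq_eq (A : Matrix (Fin m) (Fin N) ℝ) (J : Fin r → Fin N) :
    colVolSq A J = ((A.submatrix id J)ᵀ * A.submatrix id J).det := by
  rw [colVolSq, gram_rowVec_transpose]

lemma colVolSq_nonneg (A : Matrix (Fin m) (Fin N) ℝ) (J : Fin r → Fin N) : 0 ≤ colVolSq A J :=
  det_gram_nonneg _

lemma colVolSq_comp_equiv (A : Matrix (Fin m) (Fin N) ℝ) (J : Fin r → Fin N)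
    (σ : Fin r ≃ Fin r) : colVolSq A (J ∘ σ) = colVolSq A J := by
  rw [colVolSq, colVolSq]
  exact det_submatrix_equiv_self σ (gram ℝ (rowVec Aᵀ ∘ J))

lemma colVolSq_ne_zero_iff (A : Matrix (Fin m) (Fin N) ℝ) (J : Fin r → Fin N) :
    colVolSq A J ≠ 0 ↔ LinearIndependent ℝ (rowVec Aᵀ ∘ J) :=
  det_gram_ne_zero_iff_linearIndependent

lemma IsQR.transpose_mul_submatrix (h : IsQR (A.submatrix id J) Q R) :
    (Qᵀ * A).submatrix id J = R := by
  have : (Qᵀ * A).submatrix id J = Qᵀ * A.submatrix id J := by ext; rfl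
  rw [this, h.eq_mul, ← Matrix.mul_assoc, h.orthonormal_columns, Matrix.one_mul]

lemma IsQR.colVolSq_eq (h : IsQR (A.submatrix id J) Q R) : colVolSq A J = R.det ^ 2 := by
  rw [MaxVolume.colVolSq_eq, h.eq_mul, transpose_mul, Matrix.mul_assoc, ← Matrix.mul_assoc Qᵀ,
    h.orthonormal_columns, Matrix.one_mul, det_mul, det_transpose, sq]

/-- Row `i` of the adjugate consists of minors that omit column `i`. -/
lemma adjugate_updateCol_apply (R : Matrix (Fin r) (Fin r) ℝ) (i l : Fin r) (y : Fin r → ℝ) :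
    (R.updateCol i y).adjugate i l = R.adjugate i l := by
  have h : ∀ M : Matrix (Fin r) (Fin r) ℝ,
      M.adjugate i l = (M.updateCol i (Pi.single l 1)).det := fun M => by
    rw [← transpose_apply M.adjugate, adjugate_transpose, adjugate_apply, ← det_transpose,
      updateRow_transpose, transpose_transpose]
  rw [h, h, updateCol_idem]

/-- The new column splits into `Q` times its coordinates and a residual orthogonal to the range of
`Q`. The other columns have no residual, so the correction is the single entry `(i, i)`, the squared
residual length. -/
lemma gram_update_eq (h : IsQR (A.submatrix id J) Q R) (i : Fin r) (j : Fin N) :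
    (A.submatrix id (Function.update J i j))ᵀ * A.submatrix id (Function.update J i j) =
      (R.updateCol i fun l => (Qᵀ * A) l j)ᵀ * R.updateCol i (fun l => (Qᵀ * A) l j) +
        vecMulVec (colResidual A Q j • Pi.single i 1) (Pi.single i 1) := by
  set M := A.submatrix id (Function.update J i j) with hM
  set R' := R.updateCol i fun l => (Qᵀ * A) l j with hR'
  have hQM : Qᵀ * M = R' := by
    ext k l
    have e : (Qᵀ * M) k l = (Qᵀ * A) k (Function.update J i j l) := rfl
    rw [e]
    by_cases hl : l = i
    · subst hl; simp [hR']
    · rw [Function.update_of_ne hl, hR', updateCol_ne hl]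
      exact congrFun (congrFun h.transpose_mul_submatrix k) l
  set Z := M - Q * R' with hZ
  have hZ0 : ∀ a l, l ≠ i → Z a l = 0 := by
    intro a l hl
    have h1 : M a l = (Q * R) a l := by
      rw [← h.eq_mul, hM]
      simp [hl]
    have h2 : (Q * R') a l = (Q * R) a l := by
      simp only [mul_apply, hR']
      exact Finset.sum_congr rfl fun k _ => by rw [updateCol_ne hl]
    rw [hZ, Matrix.sub_apply, h1, h2, sub_self]
  have hMM : Mᵀ * M = R'ᵀ * R' + Zᵀ * Z := by
    have hQZ : Qᵀ * Z = 0 := by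
      rw [hZ, Matrix.mul_sub, hQM, ← Matrix.mul_assoc, h.orthonormal_columns, Matrix.one_mul,
        sub_self]
    have hZQ : Zᵀ * Q = 0 := by
      rw [← transpose_transpose Q, ← transpose_mul, hQZ, transpose_zero]
    have hMZ : M = Q * R' + Z := by rw [hZ]; abel
    have h1 : Qᵀ * (Q * R') = R' := by
      rw [← Matrix.mul_assoc, h.orthonormal_columns, Matrix.one_mul]
    have h2 : Zᵀ * (Q * R') = 0 := by rw [← Matrix.mul_assoc, hZQ, Matrix.zero_mul]
    rw [hMZ, transpose_add, transpose_mul, Matrix.add_mul, Matrix.mul_add, Matrix.mul_add,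
      Matrix.mul_assoc, h1, Matrix.mul_assoc, hQZ, h2, Matrix.mul_zero, add_zero, zero_add]
  rw [hMM]
  congr 1
  ext k l
  rw [vecMulVec_apply]
  by_cases hk : k = i
  · by_cases hl : l = i
    · subst hk
      subst hl
      have h1 := congrFun (congrFun hMM l) l
      rw [Matrix.add_apply] at h1
      have h2 : (Mᵀ * M) l l = ∑ a, A a j ^ 2 := by
        simp [mul_apply, hM, sq]
      have h3 : (R'ᵀ * R') l l = ∑ k, (Qᵀ * A) k j ^ 2 := by
        rw [mul_apply]
        simp [hR', sq]
      rw [h2, h3] at h1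
      rw [colResidual, h1]
      simp
    · rw [mul_apply, Finset.sum_eq_zero fun a _ => by rw [hZ0 a l hl, mul_zero]]
      simp [hl]
  · rw [mul_apply, Finset.sum_eq_zero fun a _ => by
      rw [transpose_apply, hZ0 a k hk, zero_mul]]
    simp [hk]

/-- The quantity computed by Dominant-R is the factor by which an exchange changes the squared
volume. -/
lemma IsQR.colVolSq_update (h : IsQR (A.submatrix id J) Q R) (hR : R.det ≠ 0) (i : Fin r)
    (j : Fin N) :
    colVolSq A (Function.update J i j) = exchangeFactor A Q R i j * colVolSq A J := by
  set y : Fin r → ℝ := fun l => (Qᵀ * A) l j with hy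
  rw [MaxVolume.colVolSq_eq, gram_update_eq h, det_add_vecMulVec, det_mul, det_transpose,
    h.colVolSq_eq]
  -- Cramer's rule gives the first term of `m i j`; the cofactors of `R` in `h2` give the second.
  have h1 : (R⁻¹ * (Qᵀ * A)) i j = R.det⁻¹ * (R.updateCol i y).det := by
    rw [← cramer_apply, cramer_eq_adjugate_mulVec, inv_def, Ring.inverse_eq_inv', Matrix.smul_mul,
      Matrix.smul_apply, smul_eq_mul]
    rfl
  have h2 : invRowSq R i = R.det⁻¹ ^ 2 * ∑ l, R.adjugate i l ^ 2 := by
    rw [invRowSq, inv_def, Ring.inverse_eq_inv', Finset.mul_sum]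
    simp [mul_pow]
  have h3 : Pi.single i 1 ⬝ᵥ (((R.updateCol i y)ᵀ * R.updateCol i y).adjugate *ᵥ
      (colResidual A Q j • Pi.single i 1)) = colResidual A Q j * ∑ l, R.adjugate i l ^ 2 := by
    rw [single_one_dotProduct, mulVec_smul, mulVec_single_one, Pi.smul_apply, smul_eq_mul,
      col_apply, adjugate_transpose_mul_self_apply]
    simp only [adjugate_updateCol_apply, sq]
  rw [h3, exchangeFactor, sq_abs, h1, h2]
  field_simp
  rfl

end Exchange

/-! ### Orderings of a selected set. -/

section Enumerations

variable {N r : ℕ} {I : Finset (Fin N)}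

lemma Enumerates.card_eq {J : Fin r → Fin N} (h : Enumerates J I) : I.card = r := by
  rw [← h.2, Finset.card_image_of_injective _ h.1, Finset.card_univ, Fintype.card_fin]

lemma Enumerates.apply_mem {J : Fin r → Fin N} (h : Enumerates J I) (i : Fin r) : J i ∈ I := by
  rw [← h.2]
  exact Finset.mem_image_of_mem _ (Finset.mem_univ i)

lemma Enumerates.exists_equiv {J J' : Fin r → Fin N} (h : Enumerates J I)
    (h' : Enumerates J' I) : ∃ σ : Fin r ≃ Fin r, J' = J ∘ σ := by
  have hex : ∀ k, ∃ l, J l = J' k := fun k => by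
    have := h'.apply_mem k
    rw [← h.2] at this
    simpa using this
  choose σ hσ using hex
  have hinj : Function.Injective σ := fun a b hab => h'.1 (by rw [← hσ, ← hσ, hab])
  exact ⟨Equiv.ofBijective σ (Finite.injective_iff_bijective.1 hinj), by ext k; simp [hσ]⟩

lemma Enumerates.update {J : Fin r → Fin N} (h : Enumerates J I) (i : Fin r) {j : Fin N}
    (hj : j ∉ I) : Enumerates (Function.update J i j) (insert j (I.erase (J i))) := by
  have hne : ∀ k, J k ≠ j := fun k hk => hj (hk ▸ h.apply_mem k)
  refine ⟨fun a b hab => ?_, ?_⟩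
  · by_cases ha : a = i <;> by_cases hb : b = i
    · rw [ha, hb]
    · subst ha; simp [hb] at hab; exact absurd hab.symm (hne b)
    · subst hb; simp [ha] at hab; exact absurd hab (hne a)
    · simp [ha, hb] at hab; exact h.1 hab
  · ext x
    simp only [Finset.mem_image, Finset.mem_univ, true_and, Finset.mem_insert, Finset.mem_erase]
    constructor
    · rintro ⟨k, rfl⟩
      by_cases hk : k = i
      · subst hk; simp
      · right
        rw [Function.update_of_ne hk]
        exact ⟨fun e => hk (h.1 e), h.apply_mem k⟩
    · rintro (rfl | ⟨hx, hxI⟩)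
      · exact ⟨i, by simp⟩
      · rw [← h.2] at hxI
        obtain ⟨k, _, rfl⟩ := Finset.mem_image.1 hxI
        exact ⟨k, Function.update_of_ne (fun e => hx (by rw [e])) _ _⟩

end Enumerations

/-! ### Existence of QR decompositions and orthogonal completions. -/

lemma transpose_mul_self_eq_gram {m r : ℕ} (Q : Matrix (Fin m) (Fin r) ℝ) :
    Qᵀ * Q = gram ℝ (rowVec Qᵀ) := (gram_rowVec_transpose Q id).symm

/-- Gram–Schmidt; the coefficient of column `l` on `q k` is their inner product, which vanishes for
`l < k`. -/
lemma exists_isQR {m r : ℕ} (Ahat : Matrix (Fin m) (Fin r) ℝ)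
    (hli : LinearIndependent ℝ (rowVec Ahatᵀ)) :
    ∃ (Q : Matrix (Fin m) (Fin r) ℝ) (R : Matrix (Fin r) (Fin r) ℝ), IsQR Ahat Q R := by
  set q := InnerProductSpace.gramSchmidtNormed ℝ (rowVec Ahatᵀ) with hq
  have horth : Orthonormal ℝ q := InnerProductSpace.gramSchmidtNormed_orthonormal hli
  have hspan : ∀ l, ∃ c : Fin r → ℝ, ∑ k, c k • q k = rowVec Ahatᵀ l := fun l => by
    rw [← Submodule.mem_span_range_iff_exists_fun, hq,
      InnerProductSpace.span_gramSchmidtNormed_range, InnerProductSpace.span_gramSchmidt]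
    exact Submodule.subset_span ⟨l, rfl⟩
  choose c hc using hspan
  refine ⟨Matrix.of fun a k => q k a, Matrix.of fun k l => c l k, ⟨?_, ?_, fun k l hlk => ?_⟩⟩
  · ext a l
    have := congrArg (fun v : EuclideanSpace ℝ (Fin m) => v a) (hc l)
    simp only [rowVec, transpose_apply] at this
    rw [← this, mul_apply]
    simp [mul_comm]
  · rw [transpose_mul_self_eq_gram]
    exact gram_eq_one_iff_orthonormal.2 horth
  · have h1 : inner ℝ (q k) (rowVec Ahatᵀ l) = c l k := by
      rw [← hc l]; exact horth.inner_right_fintype _ _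
    rw [of_apply, ← h1, hq, InnerProductSpace.gramSchmidtNormed, inner_smul_left,
      InnerProductSpace.gramSchmidt_inv_triangular _ _ hlk, mul_zero]

lemma exists_orthogonal_completion {m r : ℕ} (hrm : r ≤ m) (Q : Matrix (Fin m) (Fin r) ℝ)
    (hQ : Qᵀ * Q = 1) :
    ∃ Q' : Matrix (Fin m) (Fin (m - r)) ℝ, (fromCols Q Q')ᵀ * fromCols Q Q' = 1 := by
  have hq : Orthonormal ℝ (rowVec Qᵀ) := by
    rwa [transpose_mul_self_eq_gram, gram_eq_one_iff_orthonormal] at hQ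
  obtain ⟨b, hb⟩ := Orthonormal.exists_orthonormalBasis_extension_of_card_eq
    (𝕜 := ℝ) (E := EuclideanSpace ℝ (Fin m)) (ι := Fin r ⊕ Fin (m - r)) (by simp [hrm])
    (v := Sum.elim (rowVec Qᵀ) 0) (s := Set.range Sum.inl) (by
      have h1 : Orthonormal ℝ fun x : Set.range (Sum.inl : Fin r → Fin r ⊕ Fin (m - r)) =>
          rowVec Qᵀ ((Equiv.ofInjective _ Sum.inl_injective).symm x) :=
        hq.comp _ (Equiv.injective _)
      have e : (Set.range Sum.inl).domRestrict (Sum.elim (rowVec Qᵀ) 0) =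
          fun x : Set.range (Sum.inl : Fin r → Fin r ⊕ Fin (m - r)) =>
            rowVec Qᵀ ((Equiv.ofInjective _ Sum.inl_injective).symm x) := by
        funext x
        obtain ⟨_, k, rfl⟩ := x
        simp
      rw [e]
      exact h1)
  refine ⟨Matrix.of fun a k => b (Sum.inr k) a, ?_⟩
  rw [← gram_eq_one_iff_orthonormal.2 b.orthonormal]
  have hcol : ∀ (k : Fin r ⊕ Fin (m - r)) a,
      fromCols Q (Matrix.of fun a k => b (Sum.inr k) a) a k = b k a := by
    rintro (k | k) a
    · rw [hb _ ⟨k, rfl⟩]; rfl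
    · rfl
  ext k l
  rw [mul_apply, gram_apply, PiLp.inner_apply]
  refine Finset.sum_congr rfl fun a _ => ?_
  rw [transpose_apply, hcol, hcol]
  simp [mul_comm]

/-! ### Frobenius norm estimates. -/

section Frobenius

/-- The squared Frobenius norm. -/
def frobSq {a b : ℕ} (X : Matrix (Fin a) (Fin b) ℝ) : ℝ := ∑ i, ∑ j, X i j ^ 2

lemma frobSq_nonneg {a b : ℕ} (X : Matrix (Fin a) (Fin b) ℝ) : 0 ≤ frobSq X := by
  unfold frobSq; positivity

lemma dotProduct_self_nonneg {a : ℕ} (v : Fin a → ℝ) : 0 ≤ v ⬝ᵥ v :=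
  Finset.sum_nonneg fun _ _ => mul_self_nonneg _

lemma dotProduct_self_pos {a : ℕ} {v : Fin a → ℝ} (hv : v ≠ 0) : 0 < v ⬝ᵥ v :=
  (dotProduct_self_nonneg v).lt_of_ne fun h => hv (dotProduct_self_eq_zero.1 h.symm)

lemma mulVec_dotProduct_self_le {a b : ℕ} (X : Matrix (Fin a) (Fin b) ℝ) (v : Fin b → ℝ) :
    (X *ᵥ v) ⬝ᵥ (X *ᵥ v) ≤ frobSq X * (v ⬝ᵥ v) := by
  rw [frobSq, Finset.sum_mul]
  refine Finset.sum_le_sum fun i _ => ?_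
  rw [← sq]
  refine (Finset.sum_mul_sq_le_sq_mul_sq Finset.univ (X i) v).trans (le_of_eq ?_)
  simp [dotProduct, sq]

/-- Cauchy–Schwarz followed by `2 √(αq · gp) ≤ αq + gp` for the cross term. -/
lemma dotProduct_add_self_le {a : ℕ} {u v : Fin a → ℝ} {α g p q : ℝ} (hα : 0 ≤ α) (hg : 0 ≤ g)
    (hp : 0 ≤ p) (hq : 0 ≤ q) (hu : u ⬝ᵥ u ≤ α * p) (hv : v ⬝ᵥ v ≤ g * q) :
    (u + v) ⬝ᵥ (u + v) ≤ (α + g) * (p + q) := by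
  have h1 : (u ⬝ᵥ v) ^ 2 ≤ (u ⬝ᵥ u) * (v ⬝ᵥ v) := by
    have := Finset.sum_mul_sq_le_sq_mul_sq Finset.univ u v
    simpa [dotProduct, sq] using this
  have h2 : (u ⬝ᵥ u) * (v ⬝ᵥ v) ≤ (α * p) * (g * q) :=
    mul_le_mul hu hv (dotProduct_self_nonneg v) (by positivity)
  have h3 : 2 * (u ⬝ᵥ v) ≤ α * q + g * p := by
    refine (abs_le_of_sq_le_sq' (a := 2 * (u ⬝ᵥ v)) ?_ (by positivity)).2
    nlinarith [sq_nonneg (α * q - g * p)]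
  rw [add_dotProduct, dotProduct_add, dotProduct_add, dotProduct_comm v u]
  linarith

end Frobenius

/-! ### Singular value bounds for a block triangular factor. -/

section Bounds

variable {m N r k : ℕ} {M : Matrix (Fin m) (Fin N) ℝ} {A : Matrix (Fin r) (Fin r) ℝ}
  {B : Matrix (Fin r) (Fin (N - r)) ℝ} {C : Matrix (Fin k) (Fin (N - r)) ℝ}
  {P : Fin r ⊕ Fin (N - r) ≃ Fin N}

lemma dotProduct_self_split (P : Fin r ⊕ Fin (N - r) ≃ Fin N) (x : Fin N → ℝ) :
    x ⬝ᵥ x = (fun i => x (P (Sum.inl i))) ⬝ᵥ (fun i => x (P (Sum.inl i))) +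
      (fun j => x (P (Sum.inr j))) ⬝ᵥ fun j => x (P (Sum.inr j)) := by
  simp only [dotProduct]
  rw [← P.sum_comp, Fintype.sum_sum_type]

lemma dotProduct_self_le_frobSq_inv (hA : IsUnit A.det) (v : Fin r → ℝ) :
    v ⬝ᵥ v ≤ frobSq A⁻¹ * ((A *ᵥ v) ⬝ᵥ (A *ᵥ v)) := by
  have := mulVec_dotProduct_self_le A⁻¹ (A *ᵥ v)
  rwa [mulVec_mulVec, nonsing_inv_mul _ hA, one_mulVec] at this

lemma mulVec_add_mulVec_eq (hA : IsUnit A.det) (u : Fin r → ℝ) (w : Fin (N - r) → ℝ) :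
    A *ᵥ u + B *ᵥ w = A *ᵥ (u + (A⁻¹ * B) *ᵥ w) := by
  rw [mulVec_add, mulVec_mulVec, ← Matrix.mul_assoc, mul_nonsing_inv _ hA, Matrix.one_mul]

lemma sval_le_sval_leading (hA : IsUnit A.det)
    (hM : ∀ x : Fin N → ℝ, (M *ᵥ x) ⬝ᵥ (M *ᵥ x) =
      (A *ᵥ (fun i => x (P (Sum.inl i))) + B *ᵥ fun j => x (P (Sum.inr j))) ⬝ᵥ
        (A *ᵥ (fun i => x (P (Sum.inl i))) + B *ᵥ fun j => x (P (Sum.inr j))) +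
      (C *ᵥ fun j => x (P (Sum.inr j))) ⬝ᵥ (C *ᵥ fun j => x (P (Sum.inr j))))
    {K : ℝ} (hK0 : 0 ≤ K) (hK : 1 + (frobSq (A⁻¹ * B) + frobSq C * frobSq A⁻¹) ≤ K ^ 2)
    {i : ℕ} (hi : i < r) : sval M i ≤ sval A i * K := by
  obtain ⟨φ, hφ⟩ := exists_conditions_sval A hi
  set s := sval A i with hs
  have hs0 : 0 ≤ s := sval_nonneg A i
  set g := frobSq (A⁻¹ * B) with hg
  set a := frobSq A⁻¹ with ha
  set c := frobSq C with hc
  have hg0 : 0 ≤ g := frobSq_nonneg _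
  have ha0 : 0 ≤ a := frobSq_nonneg _
  have hc0 : 0 ≤ c := frobSq_nonneg _
  -- `‖A⁻¹‖²` in Frobenius norm dominates `1 / sᵢ²`; this converts the contribution of `C` into a
  -- multiple of `s²`.
  have has : 1 ≤ a * s ^ 2 := by
    obtain ⟨v, hv, hv0⟩ := exists_ne_zero_of_conditions (G := Fin r → ℝ) (by simpa using hi) φ
    have h1 := dotProduct_self_le_frobSq_inv hA v
    have h2 := mul_le_mul_of_nonneg_left (hφ v hv0) ha0
    have h3 := dotProduct_self_pos hv
    by_contra! hlt
    nlinarith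
  -- The conditions for `A` are imposed on `u + A⁻¹B w`, the vector that `A` effectively acts on.
  refine sval_le_of_conditions M (mul_nonneg hs0 hK0)
    (φ ∘ₗ (LinearMap.funLeft ℝ ℝ (fun i => P (Sum.inl i)) +
      (A⁻¹ * B).mulVecLin ∘ₗ LinearMap.funLeft ℝ ℝ fun j => P (Sum.inr j))) fun x hx => ?_
  rw [hM, dotProduct_self_split P x]
  set u : Fin r → ℝ := fun i => x (P (Sum.inl i)) with hu
  set w : Fin (N - r) → ℝ := fun j => x (P (Sum.inr j)) with hw
  rw [mulVec_add_mulVec_eq hA]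
  have h1 := hφ (u + (A⁻¹ * B) *ᵥ w) hx
  have h2 := mulVec_dotProduct_self_le C w
  have h3 : (u + (A⁻¹ * B) *ᵥ w) ⬝ᵥ (u + (A⁻¹ * B) *ᵥ w) ≤ (1 + g) * (u ⬝ᵥ u + w ⬝ᵥ w) :=
    dotProduct_add_self_le zero_le_one hg0 (dotProduct_self_nonneg u)
      (dotProduct_self_nonneg w) (by rw [one_mul]) (mulVec_dotProduct_self_le _ w)
  have hu0 := dotProduct_self_nonneg u
  have hw0 := dotProduct_self_nonneg w
  calc _ ≤ s ^ 2 * ((1 + g) * (u ⬝ᵥ u + w ⬝ᵥ w)) + (c * (w ⬝ᵥ w)) * (a * s ^ 2) := by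
        refine add_le_add (h1.trans (mul_le_mul_of_nonneg_left h3 (sq_nonneg s))) (h2.trans ?_)
        exact le_mul_of_one_le_right (by positivity) has
    _ ≤ s ^ 2 * ((1 + (g + c * a)) * (u ⬝ᵥ u + w ⬝ᵥ w)) := by
        have : 0 ≤ s ^ 2 * (c * a) * (u ⬝ᵥ u) := by positivity
        linarith
    _ ≤ s ^ 2 * (K ^ 2 * (u ⬝ᵥ u + w ⬝ᵥ w)) := by gcongr
    _ = _ := by ring

lemma sval_trailing_le_sval (hA : IsUnit A.det)
    (hM : ∀ x : Fin N → ℝ, (M *ᵥ x) ⬝ᵥ (M *ᵥ x) =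
      (A *ᵥ (fun i => x (P (Sum.inl i))) + B *ᵥ fun j => x (P (Sum.inr j))) ⬝ᵥ
        (A *ᵥ (fun i => x (P (Sum.inl i))) + B *ᵥ fun j => x (P (Sum.inr j))) +
      (C *ᵥ fun j => x (P (Sum.inr j))) ⬝ᵥ (C *ᵥ fun j => x (P (Sum.inr j))))
    {K : ℝ} (hK0 : 0 < K) (hK : 1 + (frobSq (A⁻¹ * B) + frobSq C * frobSq A⁻¹) ≤ K ^ 2)
    {j : ℕ} (hj : j < N - r) : sval C j ≤ sval M (r + j) * K := by
  obtain ⟨ψ, hψ, hψC⟩ := exists_injective_sval C hj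
  set t := sval C j with ht
  have ht0 : 0 ≤ t := sval_nonneg C j
  set g := frobSq (A⁻¹ * B) with hg
  set a := frobSq A⁻¹ with ha
  set c := frobSq C with hc
  have hg0 : 0 ≤ g := frobSq_nonneg _
  have ha0 : 0 ≤ a := frobSq_nonneg _
  have hc0 : 0 ≤ c := frobSq_nonneg _
  have htc : t ^ 2 ≤ c := by
    have hne : ψ (Pi.single 0 1) ≠ 0 := fun h => by
      have h1 : (Pi.single 0 1 : Fin (j + 1) → ℝ) = 0 := hψ (by simpa using h)
      simpa using congrFun h1 0
    exact le_of_mul_le_mul_right ((hψC _).trans (mulVec_dotProduct_self_le C _))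
      (dotProduct_self_pos hne)
  -- Test vectors `(u - A⁻¹B w, w)` with `w = ψ z`: the shift cancels `B`, leaving `‖A u‖² + ‖C
  -- w‖²`, and the space has dimension `r + j + 1`.
  let Ψ : ((Fin r → ℝ) × (Fin (j + 1) → ℝ)) →ₗ[ℝ] (Fin r ⊕ Fin (N - r) → ℝ) :=
    LinearMap.pi (Sum.rec
      (fun i => LinearMap.proj i ∘ₗ (LinearMap.fst ℝ _ _ -
        (A⁻¹ * B).mulVecLin ∘ₗ ψ ∘ₗ LinearMap.snd ℝ _ _))
      (fun i => LinearMap.proj i ∘ₗ ψ ∘ₗ LinearMap.snd ℝ _ _))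
  have hl : ∀ z i, Ψ z (Sum.inl i) = (z.1 - (A⁻¹ * B) *ᵥ ψ z.2) i := fun z i => rfl
  have hr : ∀ z i, Ψ z (Sum.inr i) = ψ z.2 i := fun z i => rfl
  rw [← div_le_iff₀ hK0]
  refine le_sval_of_injective M (i := r + j) (t := t / K)
    (G := (Fin r → ℝ) × (Fin (j + 1) → ℝ)) ?_
    (LinearMap.funLeft ℝ ℝ P.symm ∘ₗ Ψ) ?_ fun z => ?_
  · simp only [Module.finrank_prod, Module.finrank_fin_fun]
    omega
  · rw [← LinearMap.ker_eq_bot, LinearMap.ker_eq_bot']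
    intro z hz
    have hz0 : ∀ k, Ψ z k = 0 := fun k => by simpa using congrFun hz (P k)
    have h2 : z.2 = 0 := hψ (by
      rw [map_zero]; ext i; rw [← hr]; exact hz0 _)
    have h1 : z.1 = 0 := by
      ext i
      have := hz0 (Sum.inl i)
      rw [hl, h2, map_zero, mulVec_zero, sub_zero] at this
      exact this
    exact Prod.ext h1 h2
  · rw [hM, dotProduct_self_split P]
    have hxl : (fun i => (LinearMap.funLeft ℝ ℝ P.symm ∘ₗ Ψ) z (P (Sum.inl i))) =
        z.1 - (A⁻¹ * B) *ᵥ ψ z.2 := by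
      ext i; simp [← hl, LinearMap.funLeft]
    have hxr : (fun i => (LinearMap.funLeft ℝ ℝ P.symm ∘ₗ Ψ) z (P (Sum.inr i))) = ψ z.2 := by
      ext i; simp [← hr, LinearMap.funLeft]
    rw [hxl, hxr, mulVec_add_mulVec_eq hA, sub_add_cancel]
    set u := z.1 with hu
    set w := ψ z.2 with hw
    set p := (A *ᵥ u) ⬝ᵥ (A *ᵥ u) with hp
    set q := (C *ᵥ w) ⬝ᵥ (C *ᵥ w) with hq
    have hp0 : 0 ≤ p := dotProduct_self_nonneg _
    have hq0 : 0 ≤ q := dotProduct_self_nonneg _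
    have hwq : t ^ 2 * (w ⬝ᵥ w) ≤ q := hψC z.2
    -- Here `t² ≤ ‖C‖²` pays for the `u` part, and `t² ‖w‖² ≤ ‖C w‖²` for the `w` part.
    have h1 : (t • u + -(t • ((A⁻¹ * B) *ᵥ w))) ⬝ᵥ (t • u + -(t • ((A⁻¹ * B) *ᵥ w))) ≤
        (c * a + g) * (p + q) := by
      refine dotProduct_add_self_le (by positivity) hg0 hp0 hq0 ?_ ?_
      · rw [smul_dotProduct, dotProduct_smul, smul_eq_mul, smul_eq_mul, ← mul_assoc, ← sq,
          mul_assoc]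
        exact mul_le_mul htc (dotProduct_self_le_frobSq_inv hA u) (dotProduct_self_nonneg u) hc0
      · rw [neg_dotProduct_neg, smul_dotProduct, dotProduct_smul, smul_eq_mul, smul_eq_mul,
          ← mul_assoc, ← sq]
        calc _ ≤ t ^ 2 * (g * (w ⬝ᵥ w)) := by
              gcongr; exact mulVec_dotProduct_self_le _ w
          _ = g * (t ^ 2 * (w ⬝ᵥ w)) := by ring
          _ ≤ g * q := by gcongr
    have h2 : t • u + -(t • ((A⁻¹ * B) *ᵥ w)) = t • (u - (A⁻¹ * B) *ᵥ w) := by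
      rw [smul_sub, sub_eq_add_neg]
    rw [h2, smul_dotProduct, dotProduct_smul, smul_eq_mul, smul_eq_mul, ← mul_assoc, ← sq] at h1
    rw [div_pow, div_mul_eq_mul_div, div_le_iff₀ (by positivity), mul_add]
    calc _ ≤ (c * a + g) * (p + q) + q := add_le_add h1 hwq
      _ ≤ (1 + (g + c * a)) * (p + q) := by linarith
      _ ≤ K ^ 2 * (p + q) := by gcongr
      _ = _ := mul_comm _ _

end Bounds

/-! ### From the stopping test to strong rank-revealing QR. -/

section RankRevealing

variable {m N r : ℕ} {A : Matrix (Fin m) (Fin N) ℝ} {J : Fin r → Fin N}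
  {Q : Matrix (Fin m) (Fin r) ℝ} {R : Matrix (Fin r) (Fin r) ℝ}

/-- An orthogonal matrix preserves column lengths, so what `Qᵀ` misses is what `Q'ᵀ` sees. -/
lemma colResidual_eq_sum {Q' : Matrix (Fin m) (Fin (m - r)) ℝ}
    (hQ : fromCols Q Q' * (fromCols Q Q')ᵀ = 1) (j : Fin N) :
    colResidual A Q j = ∑ k, (Q'ᵀ * A) k j ^ 2 := by
  have h1 : ((fromCols Q Q')ᵀ * A)ᵀ * ((fromCols Q Q')ᵀ * A) = Aᵀ * A := by
    rw [transpose_mul, transpose_transpose, Matrix.mul_assoc, ← Matrix.mul_assoc _ _ A, hQ,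
      Matrix.one_mul]
  have h2 := congrFun (congrFun h1 j) j
  rw [transpose_fromCols, fromRows_mul, mul_apply, mul_apply, Fintype.sum_sum_type] at h2
  simp only [transpose_apply, fromRows_apply_inl, fromRows_apply_inr, ← sq] at h2
  rw [colResidual]
  linarith

lemma colResidual_nonneg (hrm : r ≤ m) (hQ : Qᵀ * Q = 1) (j : Fin N) :
    0 ≤ colResidual A Q j := by
  obtain ⟨Q', hQ'⟩ := exists_orthogonal_completion hrm Q hQ
  rw [colResidual_eq_sum ((mul_eq_one_comm_of_card_eq _ _ _ (by simp [hrm])).1 hQ')]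
  positivity

lemma invRowSq_nonneg (R : Matrix (Fin r) (Fin r) ℝ) (i : Fin r) : 0 ≤ invRowSq R i := by
  unfold invRowSq; positivity

/-- A QR decomposition in which no exchange increases the squared volume by more than `f` is
strongly rank-revealing. -/
lemma isStrongRRQR_of_exchangeFactor_le (hrm : r ≤ m) (hrN : r ≤ N) {f : ℝ} (hf : 1 < f)
    (h : IsQR (A.submatrix id J) Q R) (hR : R.det ≠ 0) {P : Fin r ⊕ Fin (N - r) ≃ Fin N}
    (hP : ∀ i, P (Sum.inl i) = J i)
    (hx : ∀ i j, exchangeFactor A Q R i (P (Sum.inr j)) ≤ f)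
    {Q' : Matrix (Fin m) (Fin (m - r)) ℝ} (hQ' : (fromCols Q Q')ᵀ * fromCols Q Q' = 1) :
    IsStrongRRQR f A (fromCols Q Q')
      ((Qᵀ * A).submatrix id fun i => P (Sum.inl i))
      ((Qᵀ * A).submatrix id fun j => P (Sum.inr j))
      ((Q'ᵀ * A).submatrix id fun j => P (Sum.inr j)) P := by
  have hQ'' : fromCols Q Q' * (fromCols Q Q')ᵀ = 1 :=
    (mul_eq_one_comm_of_card_eq _ _ _ (by simp [hrm])).1 hQ'
  have hlead : (Qᵀ * A).submatrix id (fun i => P (Sum.inl i)) = R := by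
    rw [show (fun i => P (Sum.inl i)) = J from funext hP]
    exact h.transpose_mul_submatrix
  have hunit : IsUnit R.det := isUnit_iff_ne_zero.2 hR
  have horth : Q'ᵀ * Q = 0 := by
    rw [transpose_fromCols, fromRows_mul_fromCols, ← fromBlocks_one, fromBlocks_inj] at hQ'
    exact hQ'.2.2.1
  have hzero : (Q'ᵀ * A).submatrix id (fun i => P (Sum.inl i)) = 0 := by
    rw [show (fun i => P (Sum.inl i)) = J from funext hP]
    have : (Q'ᵀ * A).submatrix id J = Q'ᵀ * A.submatrix id J := by ext; rfl
    rw [this, h.eq_mul, ← Matrix.mul_assoc, horth, Matrix.zero_mul]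
  rw [hlead]
  set B := (Qᵀ * A).submatrix id fun j => P (Sum.inr j) with hB
  set C := (Q'ᵀ * A).submatrix id fun j => P (Sum.inr j) with hC
  have hfac : A.submatrix id P = fromCols Q Q' * fromBlocks R B 0 C := by
    have h1 : fromBlocks R B 0 C = (fromCols Q Q')ᵀ * A.submatrix id P := by
      rw [transpose_fromCols, fromRows_mul, ← hlead, ← hzero]
      ext (i | i) (j | j) <;> rfl
    rw [h1, ← Matrix.mul_assoc, hQ'', Matrix.one_mul]
  have hnorm : ∀ x : Fin N → ℝ, (A *ᵥ x) ⬝ᵥ (A *ᵥ x) =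
      (R *ᵥ (fun i => x (P (Sum.inl i))) + B *ᵥ fun j => x (P (Sum.inr j))) ⬝ᵥ
        (R *ᵥ (fun i => x (P (Sum.inl i))) + B *ᵥ fun j => x (P (Sum.inr j))) +
      (C *ᵥ fun j => x (P (Sum.inr j))) ⬝ᵥ (C *ᵥ fun j => x (P (Sum.inr j))) := by
    intro x
    have h1 : A *ᵥ x = fromCols Q Q' *ᵥ (fromBlocks R B 0 C *ᵥ (x ∘ P)) := by
      rw [mulVec_mulVec, ← hfac, submatrix_mulVec_equiv]
      simp [Function.comp_assoc]
    rw [h1, dotProduct_mulVec, ← mulVec_transpose, mulVec_mulVec, hQ', one_mulVec,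
      fromBlocks_mulVec]
    simp only [dotProduct, Fintype.sum_sum_type, Sum.elim_inl, Sum.elim_inr, zero_mulVec,
      zero_add]
    rfl
  have hG : ∀ i j, (R⁻¹ * B) i j = (R⁻¹ * (Qᵀ * A)) i (P (Sum.inr j)) := fun i j => rfl
  have hres : ∀ j, 0 ≤ colResidual A Q j := colResidual_nonneg hrm h.orthonormal_columns
  have hNr : (r : ℝ) ≤ N := by exact_mod_cast hrN
  set D : ℝ := 1 + f ^ 2 * (r : ℝ) * ((N : ℝ) - (r : ℝ)) with hD
  have hD1 : 1 ≤ D := by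
    have : 0 ≤ f ^ 2 * (r : ℝ) * ((N : ℝ) - (r : ℝ)) :=
      mul_nonneg (by positivity) (sub_nonneg.2 hNr)
    linarith
  -- The test bounds the squared quantity `m` by `f`, whereas the target needs only `f²`.
  have hff : f ≤ f ^ 2 := by nlinarith
  have hbound : 1 + (frobSq (R⁻¹ * B) + frobSq C * frobSq R⁻¹) ≤ Real.sqrt D ^ 2 := by
    rw [Real.sq_sqrt (by linarith)]
    have hc : frobSq C = ∑ j, colResidual A Q (P (Sum.inr j)) := by
      rw [frobSq, Finset.sum_comm]
      exact Finset.sum_congr rfl fun j _ => (colResidual_eq_sum hQ'' _).symm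
    -- The residuals sum to `‖C‖²` and the `ω i` to `‖R⁻¹‖²`, so the error term is exactly the sum
    -- of all `m i j`.
    have h1 : frobSq (R⁻¹ * B) + frobSq C * frobSq R⁻¹ =
        ∑ i, ∑ j, exchangeFactor A Q R i (P (Sum.inr j)) := by
      rw [hc, mul_comm, frobSq, frobSq, Finset.sum_mul_sum, ← Finset.sum_add_distrib]
      refine Finset.sum_congr rfl fun i _ => ?_
      rw [← Finset.sum_add_distrib]
      refine Finset.sum_congr rfl fun j _ => ?_
      rw [exchangeFactor, sq_abs, hG, invRowSq, mul_comm (colResidual _ _ _)]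
    have h2 : ∑ i, ∑ j, exchangeFactor A Q R i (P (Sum.inr j)) ≤
        ∑ _i : Fin r, ∑ _j : Fin (N - r), f :=
      Finset.sum_le_sum fun i _ => Finset.sum_le_sum fun j _ => hx i j
    have h3 : ∑ _i : Fin r, ∑ _j : Fin (N - r), f = f * (r * ((N : ℝ) - r)) := by
      simp [Nat.cast_sub hrN]
      ring
    have h4 : f * (r * ((N : ℝ) - r)) ≤ f ^ 2 * (r * ((N : ℝ) - r)) :=
      mul_le_mul_of_nonneg_right hff (mul_nonneg (Nat.cast_nonneg _) (sub_nonneg.2 hNr))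
    rw [h1, hD]
    linarith
  have hsq : 0 < Real.sqrt D := Real.sqrt_pos.2 (by linarith)
  refine ⟨hfac, hQ', hQ'', h.upper_triangular, hunit, fun i hi => ?_, fun j hj => ?_,
    fun i j => ?_⟩
  · rw [div_le_iff₀ hsq]
    exact sval_le_sval_leading hunit hnorm hsq.le hbound hi
  · exact sval_trailing_le_sval hunit hnorm hsq hbound hj
  · have h1 := hx i j
    rw [exchangeFactor, ← hG] at h1
    have h2 := mul_nonneg (hres (P (Sum.inr j))) (invRowSq_nonneg R i)
    exact le_of_sq_le_sq (by linarith) (by linarith)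

end RankRevealing

/-! ### The greedy starting selection. -/

section PreMaxvol

variable {m N r : ℕ}

lemma exists_isPreMaxvolOutput (A : Matrix (Fin m) (Fin N) ℝ) (hr : r ≤ A.rank) :
    ∃ I₀ : Finset (Fin N), IsPreMaxvolOutput Aᵀ r I₀ := by
  rcases Nat.eq_zero_or_pos N with hN | hN
  · have : r = 0 := by
      have := A.rank_le_width
      omega
    subst this
    exact ⟨_, Fin.elim0, fun k => k.elim0, rfl⟩
  have : Nonempty (Fin N) := ⟨⟨0, hN⟩⟩
  choose g hg using fun S : Set (Fin N) => Finite.exists_max (residualSq Aᵀ S)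
  -- `T k` is the set of the first `k` choices, so the recursion can refer to the whole prefix.
  let T : ℕ → Set (Fin N) := fun k => Nat.rec ∅ (fun _ S => insert (g S) S) k
  have hT : ∀ k, T k = {x | ∃ l < k, g (T l) = x} := by
    intro k
    induction k with
    | zero => ext x; simp [T]
    | succ k ih =>
      ext x
      have hk : T (k + 1) = insert (g (T k)) (T k) := rfl
      rw [hk, Set.mem_insert_iff]
      constructor
      · rintro (rfl | hx)
        · exact ⟨k, k.lt_succ_self, rfl⟩
        · rw [ih] at hx
          obtain ⟨l, hl, rfl⟩ := hx
          exact ⟨l, hl.trans k.lt_succ_self, rfl⟩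
      · rintro ⟨l, hl, rfl⟩
        rcases Nat.lt_succ_iff_lt_or_eq.1 hl with hl | rfl
        · right; rw [ih]; exact ⟨l, hl, rfl⟩
        · exact Or.inl rfl
  refine ⟨_, fun k : Fin r => g (T k), fun k i => ?_, rfl⟩
  have e : (fun k : Fin r => g (T k)) '' {l | l < k} = T k := by
    rw [hT k]
    ext x
    constructor
    · rintro ⟨l, hl, rfl⟩
      exact ⟨l, hl, rfl⟩
    · rintro ⟨l, hl, rfl⟩
      exact ⟨⟨l, hl.trans k.2⟩, hl, rfl⟩
  rw [e]
  exact hg _ i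

lemma exists_colVolSq_ne_zero (A : Matrix (Fin m) (Fin N) ℝ) (hr : r ≤ A.rank) :
    ∃ J : Fin r → Fin N, colVolSq A J ≠ 0 := by
  obtain ⟨v, hv, -, hli⟩ := Submodule.exists_fun_fin_finrank_span_eq ℝ (Set.range A.col)
  rw [rank_eq_finrank_span_cols] at hr
  choose J hJ using hv
  refine ⟨J ∘ Fin.castLE hr, (colVolSq_ne_zero_iff _ _).2 ?_⟩
  have h1 := (hli.comp _ (Fin.castLE_injective hr)).map'
    (WithLp.linearEquiv 2 ℝ (Fin m → ℝ)).symm.toLinearMap (LinearEquiv.ker _)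
  have e : rowVec Aᵀ ∘ J ∘ Fin.castLE hr =
      (WithLp.linearEquiv 2 ℝ (Fin m → ℝ)).symm.toLinearMap ∘ v ∘ Fin.castLE hr := by
    funext k
    change WithLp.toLp 2 (A.col (J (Fin.castLE hr k))) = WithLp.toLp 2 (v (Fin.castLE hr k))
    rw [hJ]
  rw [e]
  exact h1

/-- The output of pre-maxvol has the largest volume up to the factor `r!`. -/
lemma IsPreMaxvolOutput.exists_enumerates {A : Matrix (Fin m) (Fin N) ℝ} (hr : r ≤ A.rank)
    {I : Finset (Fin N)} (h : IsPreMaxvolOutput Aᵀ r I) :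
    ∃ s : Fin r → Fin N, Enumerates s I ∧ 0 < colVolSq A s ∧
      ∀ J : Fin r → Fin N, colVolSq A J ≤ (r.factorial : ℝ) ^ 2 * colVolSq A s := by
  obtain ⟨s, hs, rfl⟩ := h
  have hle : ∀ J : Fin r → Fin N, colVolSq A J ≤ (r.factorial : ℝ) ^ 2 * colVolSq A s :=
    det_gram_le_of_greedy _ _ fun k i => le_of_sq_le_sq (hs k i) (norm_nonneg _)
  obtain ⟨J, hJ⟩ := exists_colVolSq_ne_zero A hr
  have hne : colVolSq A s ≠ 0 := fun h0 => by
    have h1 := hle J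
    rw [h0, mul_zero] at h1
    exact hJ (le_antisymm h1 (colVolSq_nonneg A J))
  refine ⟨s, ⟨?_, rfl⟩, (colVolSq_nonneg A s).lt_of_ne' hne, hle⟩
  -- Nonzero volume makes the chosen columns independent, hence no index repeats.
  exact Function.Injective.of_comp ((colVolSq_ne_zero_iff A s).1 hne).injective

end PreMaxvol

/-! ### Swap count, termination and the final selection. -/

section DominantR

variable {m N r : ℕ} {A : Matrix (Fin m) (Fin N) ℝ} {f : ℝ}

lemma Enumerates.colVolSq_eq {I : Finset (Fin N)} {J J' : Fin r → Fin N} (h : Enumerates J I)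
    (h' : Enumerates J' I) : colVolSq A J' = colVolSq A J := by
  obtain ⟨σ, rfl⟩ := h.exists_equiv h'
  exact colVolSq_comp_equiv A J σ

/-- Every swap multiplies the squared volume by more than `f`. -/
lemma DominantRStep.mul_colVolSq_le {I I' : Finset (Fin N)} (h : DominantRStep A r f I I')
    {J : Fin r → Fin N} (hJ : Enumerates J I) (hpos : 0 < colVolSq A J) :
    ∃ J' : Fin r → Fin N, Enumerates J' I' ∧ f * colVolSq A J ≤ colVolSq A J' := by
  obtain ⟨J₀, Q, R, hJ₀, hQR, i, j, hj, -, hf, rfl⟩ := h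
  have hvol : colVolSq A J₀ = colVolSq A J := hJ.colVolSq_eq hJ₀
  have hR : R.det ≠ 0 := fun h0 => by
    have := hQR.colVolSq_eq
    rw [hvol, h0] at this
    simp [this] at hpos
  refine ⟨_, hJ₀.update i hj, ?_⟩
  rw [hQR.colVolSq_update hR, hvol]
  exact mul_le_mul_of_nonneg_right hf.le hpos.le

lemma IsDominantRRun.pow_mul_colVolSq_le (hf : 1 < f) {k : ℕ} {S : ℕ → Finset (Fin N)}
    (h : IsDominantRRun A r f k S) {s : Fin r → Fin N} (hs : Enumerates s (S 0))
    (hpos : 0 < colVolSq A s) :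
    ∃ J : Fin r → Fin N, Enumerates J (S k) ∧ f ^ k * colVolSq A s ≤ colVolSq A J := by
  induction k with
  | zero => exact ⟨s, hs, by simp⟩
  | succ k ih =>
    obtain ⟨J, hJ, hle⟩ := ih fun t ht => h t (ht.trans k.lt_succ_self)
    have hJpos : 0 < colVolSq A J := lt_of_lt_of_le (by positivity) hle
    obtain ⟨J', hJ', hle'⟩ := (h k k.lt_succ_self).mul_colVolSq_le hJ hJpos
    refine ⟨J', hJ', le_trans ?_ hle'⟩
    rw [pow_succ', mul_assoc]
    gcongr

/-- Logarithms after `r! ≤ r ^ r`. The case `r = 0` fits, with `0 ^ 0 = 1` and `Real.log 0 = 0`. -/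
lemma natCast_le_of_pow_le_factorial_sq (hf : 1 < f) {k : ℕ}
    (h : f ^ k ≤ (r.factorial : ℝ) ^ 2) : (k : ℝ) ≤ 2 * ((r : ℝ) * Real.logb f r) := by
  have h1 : f ^ k ≤ (r : ℝ) ^ (2 * r) := by
    refine h.trans ?_
    rw [mul_comm 2 r, pow_mul]
    gcongr
    exact_mod_cast r.factorial_le_pow
  have hlog := Real.log_pos hf
  have h2 := Real.log_le_log (by positivity) h1
  rw [Real.log_pow, Real.log_pow] at h2
  rw [Real.logb, ← mul_div_assoc, ← mul_div_assoc, le_div_iff₀ hlog]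
  push_cast at h2
  linarith

/-- A run never gets stuck: with the bound on the number of swaps, this gives termination. -/
lemma dominantRStops_or_step {I : Finset (Fin N)} {J : Fin r → Fin N} (hJ : Enumerates J I)
    (hne : colVolSq A J ≠ 0) :
    DominantRStops A r f I ∨ ∃ I', DominantRStep A r f I I' := by
  obtain ⟨Q, R, hQR⟩ := exists_isQR (A.submatrix id J) ((colVolSq_ne_zero_iff A J).1 hne)
  by_cases hterm : ∀ (i : Fin r) (j : Fin N), j ∉ I → exchangeFactor A Q R i j ≤ f
  · exact Or.inl ⟨J, Q, R, hJ, hQR, hterm⟩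
  · right
    push Not at hterm
    obtain ⟨i₀, j₀, hj₀, hlt⟩ := hterm
    obtain ⟨p, hp, hmax⟩ := Finset.exists_max_image
      ((Finset.univ : Finset (Fin r × Fin N)).filter fun p => p.2 ∉ I)
      (fun p => exchangeFactor A Q R p.1 p.2) ⟨(i₀, j₀), by simpa using hj₀⟩
    have hmax' : ∀ (i' : Fin r) (j' : Fin N), j' ∉ I →
        exchangeFactor A Q R i' j' ≤ exchangeFactor A Q R p.1 p.2 :=
      fun i' j' hj' => hmax (i', j') (by simpa using hj')
    exact ⟨_, J, Q, R, hJ, hQR, p.1, p.2, by simpa using hp, hmax',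
      hlt.trans_le (hmax' i₀ j₀ hj₀), rfl⟩

/-- The stopping test does not depend on the order of the selected columns or on the QR
decomposition. -/
lemma DominantRStops.exchangeFactor_le {I : Finset (Fin N)} (h : DominantRStops A r f I)
    {J : Fin r → Fin N} (hJ : Enumerates J I) (hne : colVolSq A J ≠ 0)
    {Q : Matrix (Fin m) (Fin r) ℝ} {R : Matrix (Fin r) (Fin r) ℝ}
    (hQR : IsQR (A.submatrix id J) Q R) (hR : R.det ≠ 0) (i : Fin r) {j : Fin N} (hj : j ∉ I) :
    exchangeFactor A Q R i j ≤ f := by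
  obtain ⟨J₀, Q₀, R₀, hJ₀, hQR₀, hle⟩ := h
  obtain ⟨σ, rfl⟩ := hJ₀.exists_equiv hJ
  have hvol : colVolSq A (J₀ ∘ σ) = colVolSq A J₀ := colVolSq_comp_equiv A J₀ σ
  have hR₀ : R₀.det ≠ 0 := fun h0 => hne (by rw [hvol, hQR₀.colVolSq_eq, h0]; simp)
  have h1 := hQR.colVolSq_update hR i j
  have h2 := hQR₀.colVolSq_update hR₀ (σ i) j
  -- The two exchanges yield the same set of columns, so their volume ratios, and hence the two
  -- values of `m`, agree.
  have h3 : Function.update (J₀ ∘ σ) i j = Function.update J₀ (σ i) j ∘ σ := by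
    ext k
    by_cases hk : k = i
    · subst hk; simp
    · simp [hk]
  rw [h3, colVolSq_comp_equiv, h2, hvol] at h1
  rw [← mul_right_cancel₀ (hvol ▸ hne) h1]
  exact hle _ _ hj

lemma DominantRStops.isThinStrongRRQR (hr : r ≤ A.rank) (hf : 1 < f) {I : Finset (Fin N)}
    (h : DominantRStops A r f I) {J : Fin r → Fin N} (hJ : Enumerates J I)
    (hne : colVolSq A J ≠ 0) {Q : Matrix (Fin m) (Fin r) ℝ} {R : Matrix (Fin r) (Fin r) ℝ}
    (hQR : IsQR (A.submatrix id J) Q R) {P : Fin r ⊕ Fin (N - r) ≃ Fin N}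
    (hP : ∀ i, P (Sum.inl i) = J i) : IsThinStrongRRQR f A Q (Qᵀ * A) P := by
  have hrm : r ≤ m := hr.trans A.rank_le_height
  have hrN : r ≤ N := hr.trans A.rank_le_width
  have hR : R.det ≠ 0 := fun h0 => hne (by rw [hQR.colVolSq_eq, h0]; simp)
  refine ⟨exists_orthogonal_completion hrm Q hQR.orthonormal_columns, fun Q' hQ' => ?_⟩
  refine isStrongRRQR_of_exchangeFactor_le hrm hrN hf hQR hR hP (fun i j => ?_) hQ'
  refine h.exchangeFactor_le hJ hne hQR hR i fun hmem => ?_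
  rw [← hJ.2] at hmem
  obtain ⟨k, _, hk⟩ := Finset.mem_image.1 hmem
  rw [← hP] at hk
  simpa using P.injective hk

end DominantR

end MaxVolume

theorem theorem2 :
    ∃ c : ℝ, ∀ (m N r : ℕ) (A : Matrix (Fin m) (Fin N) ℝ) (f : ℝ), 1 < f → r ≤ A.rank →
      (∃ I₀ : Finset (Fin N), MaxVolume.IsPreMaxvolOutput A.transpose r I₀) ∧
      ∀ (k : ℕ) (S : ℕ → Finset (Fin N)),
        MaxVolume.IsPreMaxvolOutput A.transpose r (S 0) →
        MaxVolume.IsDominantRRun A r f k S →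
        (k : ℝ) ≤ c * ((r : ℝ) * Real.logb f (r : ℝ)) ∧
        (S k).card = r ∧
        (MaxVolume.DominantRStops A r f (S k) ∨
          ∃ I' : Finset (Fin N), MaxVolume.DominantRStep A r f (S k) I') ∧
        (MaxVolume.DominantRStops A r f (S k) →
          ∀ (J : Fin r → Fin N) (Q : Matrix (Fin m) (Fin r) ℝ) (R : Matrix (Fin r) (Fin r) ℝ)
            (P : Fin r ⊕ Fin (N - r) ≃ Fin N),
            MaxVolume.Enumerates J (S k) →
            MaxVolume.IsQR (A.submatrix id J) Q R →
            (∀ i : Fin r, P (Sum.inl i) = J i) →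
            (Q.transpose * A).submatrix id J = R ∧
            MaxVolume.IsThinStrongRRQR f A Q (Q.transpose * A) P) := by
  -- The constant `2` is the exponent in `(r!)²`, as volumes are squared while each swap gains only
  -- `f`.
  refine ⟨2, fun m N r A f hf hr => ⟨MaxVolume.exists_isPreMaxvolOutput A hr, ?_⟩⟩
  intro k S hS hrun
  obtain ⟨s, hs, hpos, hmax⟩ := hS.exists_enumerates hr
  obtain ⟨J₀, hJ₀, hle⟩ := hrun.pow_mul_colVolSq_le hf hs hpos
  have hJ₀pos : 0 < MaxVolume.colVolSq A J₀ := lt_of_lt_of_le (by positivity) hle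
  refine ⟨MaxVolume.natCast_le_of_pow_le_factorial_sq hf
      (le_of_mul_le_mul_right (hle.trans (hmax J₀)) hpos), hJ₀.card_eq,
    MaxVolume.dominantRStops_or_step hJ₀ hJ₀pos.ne', ?_⟩
  intro hterm J Q R P hJ hQR hP
  exact ⟨hQR.transpose_mul_submatrix, hterm.isThinStrongRRQR hr hf hJ
    (by rw [hJ₀.colVolSq_eq hJ]; exact hJ₀pos.ne') hQR hP⟩
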